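/- A \emph{ray} is a one-way infinite path and a \emph{double ray} is a two-way infinite path. Two rays in a graph $G$ are \emph{equivalent} if no finite set of vertices separates them in $G$; the equivalence classes of rays under this relation are the \emph{ends} of $G$, and a ray \emph{converges} to the end that contains it. The \emph{vertex-degree} of an end is the maximal number of pairwise vertex-disjoint rays in it, and an end is \emph{thin} if its vertex-degree is finite. Let $G$ be a countable (simple, undirected) graph and let $\omega$ be a thin end of $G$. Assume that for every $k\in\mathbb{N}$ there are $k$ pairwise edge-disjoint double rays in $G$ such that every ray included in one of them converges to $\omega$. Then $G$ has an infinite set of pairwise edge-disjoint double rays. -/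

import Mathlib

namespace SimpleGraph

variable {V : Type*}

/-- A ray (one-way infinite path) of `G`, listed from its first vertex. -/
structure Ray (G : SimpleGraph V) where
  vertex : ℕ → V
  injective : Function.Injective vertex
  adj : ∀ i, G.Adj (vertex i) (vertex (i + 1))

/-- A double ray (two-way infinite path) of `G`. -/
structure DoubleRay (G : SimpleGraph V) where
  vertex : ℤ → V
  injective : Function.Injective vertex
  adj : ∀ i, G.Adj (vertex i) (vertex (i + 1))

/-- `S` separates `A` from `B` in `G` if every path from `A` to `B` meets `S`. -/
def SeparatesSets (G : SimpleGraph V) (S A B : Set V) : Prop :=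
  ∀ a ∈ A, ∀ b ∈ B, ∀ p : G.Walk a b, p.IsPath → ∃ x ∈ p.support, x ∈ S

namespace Ray

variable {G : SimpleGraph V}

/-- The vertex set of a ray. -/
def verts (R : G.Ray) : Set V := Set.range R.vertex

/-- The edge set of a ray. -/
def edges (R : G.Ray) : Set (Sym2 V) :=
  Set.range fun i : ℕ => s(R.vertex i, R.vertex (i + 1))

/-- Two rays are equivalent if no finite set of vertices separates them. -/
def Equivalent (R R' : G.Ray) : Prop :=
  ∀ S : Set V, S.Finite → ¬ G.SeparatesSets S R.verts R'.verts

theorem equivalent_iff (R R' : G.Ray) : R.Equivalent R' ↔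
    ∀ S : Set V, S.Finite →
      ∃ m n, ∃ p : G.Walk (R.vertex m) (R'.vertex n), ∀ x ∈ p.support, x ∉ S := by
  classical
  refine forall₂_congr fun S _ => ?_
  constructor
  · intro h
    simp only [SeparatesSets] at h
    push Not at h
    obtain ⟨_, ⟨m, rfl⟩, _, ⟨n, rfl⟩, p, _, hp⟩ := h
    exact ⟨m, n, p, hp⟩
  · rintro ⟨m, n, p, hp⟩ h
    obtain ⟨x, hx, hxS⟩ := h _ ⟨m, rfl⟩ _ ⟨n, rfl⟩ p.bypass p.bypass_isPath
    exact hp x (p.support_bypass_subset_support hx) hxS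

theorem exists_walk (R : G.Ray) (m k : ℕ) :
    ∃ p : G.Walk (R.vertex m) (R.vertex (m + k)),
      ∀ x ∈ p.support, ∃ i, m ≤ i ∧ x = R.vertex i := by
  induction k with
  | zero => exact ⟨Walk.nil, fun x hx => ⟨m, le_rfl, by simpa using hx⟩⟩
  | succ k ih =>
    obtain ⟨p, hp⟩ := ih
    refine ⟨p.concat (R.adj (m + k)), fun x hx => ?_⟩
    rw [Walk.support_concat, List.mem_append] at hx
    rcases hx with hx | hx
    · exact hp x hx
    · exact ⟨m + (k + 1), by omega, by simpa using hx⟩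

theorem exists_tail (R : G.Ray) {S : Set V} (hS : S.Finite) :
    ∃ N, ∀ i, N ≤ i → R.vertex i ∉ S := by
  obtain ⟨N, hN⟩ := (hS.preimage R.injective.injOn).bddAbove
  exact ⟨N + 1, fun i hi h => absurd (hN h) (by omega)⟩

theorem Equivalent.refl (R : G.Ray) : R.Equivalent R := by
  rw [equivalent_iff]
  intro S hS
  obtain ⟨N, hN⟩ := R.exists_tail hS
  exact ⟨N, N, Walk.nil, fun x hx => by
    rw [Walk.support_nil, List.mem_singleton] at hx
    exact hx ▸ hN N le_rfl⟩

theorem Equivalent.symm {R R' : G.Ray} (h : R.Equivalent R') : R'.Equivalent R := by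
  rw [equivalent_iff] at h ⊢
  intro S hS
  obtain ⟨m, n, p, hp⟩ := h S hS
  exact ⟨n, m, p.reverse, fun x hx => hp x (by simpa using hx)⟩

theorem Equivalent.trans {R R' R'' : G.Ray} (h : R.Equivalent R') (h' : R'.Equivalent R'') :
    R.Equivalent R'' := by
  rw [equivalent_iff] at h h' ⊢
  intro S hS
  obtain ⟨N, hN⟩ := R'.exists_tail hS
  have hT : (S ∪ R'.vertex '' Set.Iio N).Finite := hS.union ((Set.finite_Iio N).image _)
  have avoid : ∀ {x}, x ∉ S ∪ R'.vertex '' Set.Iio N → x ∉ S := fun hx hxS => hx (Or.inl hxS)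
  have late : ∀ {i}, R'.vertex i ∉ S ∪ R'.vertex '' Set.Iio N → N ≤ i := fun {i} hi => by
    by_contra hlt
    exact hi (Or.inr ⟨i, not_le.mp hlt, rfl⟩)
  obtain ⟨m, n, p, hp⟩ := h _ hT
  obtain ⟨m', n', q, hq⟩ := h' _ hT
  have hn : N ≤ n := late (hp _ p.end_mem_support)
  have hm : N ≤ m' := late (hq _ q.start_mem_support)
  have key : ∃ w : G.Walk (R'.vertex n) (R'.vertex m'), ∀ x ∈ w.support, x ∉ S := by
    rcases le_total n m' with hle | hle
    · obtain ⟨k, rfl⟩ := Nat.exists_eq_add_of_le hle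
      obtain ⟨w, hw⟩ := R'.exists_walk n k
      refine ⟨w, fun x hx => ?_⟩
      obtain ⟨i, hi, rfl⟩ := hw x hx
      exact hN i (hn.trans hi)
    · obtain ⟨k, rfl⟩ := Nat.exists_eq_add_of_le hle
      obtain ⟨w, hw⟩ := R'.exists_walk m' k
      refine ⟨w.reverse, fun x hx => ?_⟩
      obtain ⟨i, hi, rfl⟩ := hw x (by simpa using hx)
      exact hN i (hm.trans hi)
  obtain ⟨w, hw⟩ := key
  refine ⟨m, n', (p.append w).append q, fun x hx => ?_⟩
  rw [Walk.mem_support_append_iff, Walk.mem_support_append_iff] at hx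
  rcases hx with (hx | hx) | hx
  · exact avoid (hp x hx)
  · exact hw x hx
  · exact avoid (hq x hx)

end Ray

/-- Equivalence of rays. -/
def raySetoid (G : SimpleGraph V) : Setoid G.Ray where
  r := Ray.Equivalent
  iseqv := ⟨Ray.Equivalent.refl, Ray.Equivalent.symm, Ray.Equivalent.trans⟩

/-- The ends of `G`: the equivalence classes of its rays. -/
def RayEnd (G : SimpleGraph V) : Type _ := Quotient G.raySetoid

/-- A ray converges to the end that it belongs to. -/
def Ray.ConvergesTo {G : SimpleGraph V} (R : G.Ray) (ω : G.RayEnd) : Prop :=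
  Quotient.mk G.raySetoid R = ω

/-- The vertex-degree of an end: the maximal number of pairwise vertex-disjoint rays in it
(all infinite cardinalities are identified with `⊤`). -/
noncomputable def RayEnd.vertexDegree {G : SimpleGraph V} (ω : G.RayEnd) : ℕ∞ :=
  ⨆ (𝓡 : Set G.Ray) (_ : (∀ R ∈ 𝓡, R.ConvergesTo ω) ∧
    𝓡.Pairwise fun R R' => Disjoint R.verts R'.verts), 𝓡.encard

/-- An end is thin if its vertex-degree is finite. -/
def RayEnd.IsThin {G : SimpleGraph V} (ω : G.RayEnd) : Prop :=
  ω.vertexDegree ≠ ⊤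

namespace DoubleRay

variable {G : SimpleGraph V}

/-- The vertex set of a double ray. -/
def verts (D : G.DoubleRay) : Set V := Set.range D.vertex

/-- The edge set of a double ray. -/
def edges (D : G.DoubleRay) : Set (Sym2 V) :=
  Set.range fun i : ℤ => s(D.vertex i, D.vertex (i + 1))

/-- The double ray `D` includes the ray `R` as a subgraph. -/
def Includes (D : G.DoubleRay) (R : G.Ray) : Prop :=
  R.verts ⊆ D.verts ∧ R.edges ⊆ D.edges

/-- Two double rays are edge-disjoint if they have no common edge. -/
def EdgeDisjoint (D D' : G.DoubleRay) : Prop := Disjoint D.edges D'.edges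

end DoubleRay

end SimpleGraph

/-! An end that is dominated by infinitely many vertices contains arbitrarily many disjoint rays
(`exists_rays_of_dominating`), so a thin end has only finitely many dominating vertices. Deleting
them may destroy the given double rays, but tails of their two halves survive. Such edge-disjoint
pairs of disjoint rays are all that is needed, and the end has become undominated.

For an undominated end, thinness bounds the number of vertices needed to separate any finite set
from it (`exists_separator_card_le`). Let d be the least number for which some κ exists such that
every finite set can be separated from the end by at most d vertices together with at most κ edges.
The pairs of rays give d ≥ 2. By minimality of d, separators of large finite sets that use fewer
than d vertices need more edges than any prescribed bound.

Take such separators further and further out, all with exactly d vertices. Between consecutive ones,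
Menger's theorem with capacity m at vertices and capacity 1 at edges gives m * d paths, and König's
edge-colouring theorem sorts them into m edge-disjoint linkages, each consisting of d
vertex-disjoint paths (`exists_edgeDisjoint_linkages`).

Level n has n + 2 linkages. Two of them, together with a walk joining two vertices of the separator
on its far side, provide a turn, that is, a connection between two vertices of the next separator
(`exists_turn`). The other n linkages stay untouched. The double ray with index l makes its turn on
level l and follows linkage number l on all later levels. Different levels use disjoint sets of
edges, so these infinitely many double rays are edge-disjoint. -/

/-! ### Finite combinatorics: hitting sets, Hall's theorem, König's edge-colouring theorem. -/

/-- A family of finite sets that has no hitting set with fewer than `k` elements has a finite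
subfamily with this property. -/
theorem exists_finite_subfamily_of_no_small_transversal {α : Type*} (k : ℕ) :
    ∀ 𝒲 : Set (Finset α),
      (∀ Y : Finset α, (∀ W ∈ 𝒲, ∃ x ∈ W, x ∈ Y) → k ≤ Y.card) →
      ∃ 𝒲' : Finset (Finset α), (𝒲' : Set (Finset α)) ⊆ 𝒲 ∧
        ∀ Y : Finset α, (∀ W ∈ 𝒲', ∃ x ∈ W, x ∈ Y) → k ≤ Y.card := by
  classical
  induction k with
  | zero => exact fun 𝒲 _ => ⟨∅, by simp, by simp⟩
  | succ k ih =>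
    intro 𝒲 h
    obtain ⟨W₀, hW₀⟩ : 𝒲.Nonempty := by
      by_contra hne
      rw [Set.not_nonempty_iff_eq_empty] at hne
      simpa using h ∅ (by simp [hne])
    have key : ∀ x : α, ∃ 𝒲' : Finset (Finset α), (𝒲' : Set (Finset α)) ⊆ {W ∈ 𝒲 | x ∉ W} ∧
        ∀ Y : Finset α, (∀ W ∈ 𝒲', ∃ x ∈ W, x ∈ Y) → k ≤ Y.card := by
      refine fun x => ih _ fun Y hY => ?_
      have := h (insert x Y) fun W hW => by
        by_cases hx : x ∈ W
        · exact ⟨x, hx, by simp⟩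
        · obtain ⟨y, hy, hyY⟩ := hY W ⟨hW, hx⟩
          exact ⟨y, hy, by simp [hyY]⟩
      have := Finset.card_insert_le x Y
      omega
    choose 𝒱 h𝒱 h𝒱' using key
    refine ⟨insert W₀ (W₀.biUnion 𝒱), ?_, fun Y hY => ?_⟩
    · intro W hW
      simp only [Finset.coe_insert, Set.mem_insert_iff, Finset.mem_coe, Finset.mem_biUnion] at hW
      rcases hW with rfl | ⟨x, _, hx⟩
      · exact hW₀
      · exact (h𝒱 x hx).1
    · obtain ⟨x, hxW, hxY⟩ := hY W₀ (by simp)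
      have := h𝒱' x (Y.erase x) fun W hW => by
        obtain ⟨y, hy, hyY⟩ := hY W (by
          simp only [Finset.mem_insert, Finset.mem_biUnion]; exact Or.inr ⟨x, hxW, hW⟩)
        refine ⟨y, hy, Finset.mem_erase.2 ⟨?_, hyY⟩⟩
        rintro rfl
        exact (h𝒱 _ hW).2 hy
      rw [Finset.card_erase_of_mem hxY] at this
      have := Finset.card_pos.2 ⟨x, hxY⟩
      omega

/-- Hall's marriage theorem for a finite set of indices. -/
theorem Finset.exists_injOn_of_card_le_biUnion_card {X Y : Type*} [DecidableEq Y] [Nonempty Y]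
    (A : Finset X) (t : X → Finset Y) (h : ∀ S ⊆ A, S.card ≤ (S.biUnion t).card) :
    ∃ f : X → Y, Set.InjOn f A ∧ ∀ x ∈ A, f x ∈ t x := by
  classical
  obtain ⟨f, hf, hft⟩ := (Finset.all_card_le_biUnion_card_iff_exists_injective
    (fun x : A => t x)).1 fun s => by
      have := h (s.map (Function.Embedding.subtype _)) (by
        intro x hx
        simp only [Finset.mem_map] at hx
        obtain ⟨y, _, rfl⟩ := hx
        exact y.2)
      rw [Finset.card_map] at this
      refine this.trans (Finset.card_le_card ?_)
      intro y hy
      simp only [Finset.mem_biUnion, Finset.mem_map] at hy ⊢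
      obtain ⟨_, ⟨x, hx, rfl⟩, hy⟩ := hy
      exact ⟨x, hx, hy⟩
  refine ⟨fun x => if hx : x ∈ A then f ⟨x, hx⟩ else Classical.arbitrary Y, ?_, ?_⟩
  · intro x hx y hy hxy
    have hx' : x ∈ A := hx
    have hy' : y ∈ A := hy
    simp only [hx', hy', dite_true] at hxy
    simpa using hf hxy
  · intro x hx
    simpa [hx] using hft ⟨x, hx⟩

/-- A regular bipartite multigraph of degree `m` is properly edge-colourable with `m` colours. -/
theorem exists_proper_edge_colouring {ε X Y : Type*} (a : ε → X) (b : ε → Y)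
    (A : Finset X) (B : Finset Y) [DecidableEq X] [DecidableEq Y] (m : ℕ) :
    ∀ S : Finset ε, (∀ e ∈ S, a e ∈ A) → (∀ e ∈ S, b e ∈ B) →
      (∀ x ∈ A, {e ∈ S | a e = x}.card = m) → (∀ y ∈ B, {e ∈ S | b e = y}.card = m) →
      ∃ c : ε → ℕ, (∀ e ∈ S, c e < m) ∧
        ∀ e ∈ S, ∀ e' ∈ S, a e = a e' ∨ b e = b e' → c e = c e' → e = e' := by
  classical
  induction m with
  | zero =>
    intro S hA hB hAm hBm
    have hS : S = ∅ := by
      by_contra hne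
      obtain ⟨e, he⟩ := Finset.nonempty_iff_ne_empty.2 hne
      have := Finset.card_eq_zero.1 (hAm _ (hA e he))
      have : e ∈ ({e' ∈ S | a e' = a e} : Finset ε) := by simp [he]
      simp_all
    exact ⟨fun _ => 0, by simp [hS], by simp [hS]⟩
  | succ m ih =>
    intro S hA hB hAm hBm
    have hcA : S.card = (m + 1) * A.card := by
      rw [Finset.card_eq_sum_card_fiberwise (f := a) (t := A) hA, Finset.sum_congr rfl hAm]
      simp [mul_comm]
    have hcB : S.card = (m + 1) * B.card := by
      rw [Finset.card_eq_sum_card_fiberwise (f := b) (t := B) hB, Finset.sum_congr rfl hBm]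
      simp [mul_comm]
    have hAB : A.card = B.card := Nat.eq_of_mul_eq_mul_left (Nat.succ_pos m) (hcA.symm.trans hcB)
    rcases A.eq_empty_or_nonempty with hAe | ⟨x₀, hx₀⟩
    · have : S = ∅ := by
        rw [← Finset.card_eq_zero, hcA, hAe]; simp
      exact ⟨fun _ => 0, by simp [this], by simp [this]⟩
    have : Nonempty Y := by
      have : 0 < B.card := hAB ▸ Finset.card_pos.2 ⟨x₀, hx₀⟩
      exact ⟨(Finset.card_pos.1 this).choose⟩
    -- Double counting gives Hall's condition: the `(m + 1) * T.card` edges at `T` all end in `N`,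
    -- which meets only `(m + 1) * N.card` edges.
    obtain ⟨f, hf, hft⟩ := A.exists_injOn_of_card_le_biUnion_card
      (fun x => {e ∈ S | a e = x}.image b) (by
        intro T hT
        set N := T.biUnion fun x => {e ∈ S | a e = x}.image b with hN
        have hNB : N ⊆ B := by
          intro y hy
          simp only [hN, Finset.mem_biUnion, Finset.mem_image, Finset.mem_filter] at hy
          obtain ⟨_, _, e, ⟨he, _⟩, rfl⟩ := hy
          exact hB e he
        have h1 : {e ∈ S | a e ∈ T}.card = (m + 1) * T.card := by
          rw [Finset.card_eq_sum_card_fiberwise (f := a) (t := T) (fun e he => by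
            simpa using (Finset.mem_filter.1 he).2)]
          rw [Finset.sum_congr rfl (g := fun _ => m + 1)]
          · simp [mul_comm]
          · intro x hx
            rw [← hAm x (hT hx)]
            congr 1
            ext e
            simp only [Finset.mem_filter]
            constructor
            · rintro ⟨⟨h, _⟩, h'⟩; exact ⟨h, h'⟩
            · rintro ⟨h, rfl⟩; exact ⟨⟨h, hx⟩, rfl⟩
        have h2 : {e ∈ S | b e ∈ N}.card = (m + 1) * N.card := by
          rw [Finset.card_eq_sum_card_fiberwise (f := b) (t := N) (fun e he => by
            simpa using (Finset.mem_filter.1 he).2)]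
          rw [Finset.sum_congr rfl (g := fun _ => m + 1)]
          · simp [mul_comm]
          · intro x hx
            rw [← hBm x (hNB hx)]
            congr 1
            ext e
            simp only [Finset.mem_filter]
            constructor
            · rintro ⟨⟨h, _⟩, h'⟩; exact ⟨h, h'⟩
            · rintro ⟨h, rfl⟩; exact ⟨⟨h, hx⟩, rfl⟩
        have h3 : ({e ∈ S | a e ∈ T} : Finset ε) ⊆ {e ∈ S | b e ∈ N} := by
          intro e he
          simp only [Finset.mem_filter] at he ⊢
          refine ⟨he.1, ?_⟩
          simp only [hN, Finset.mem_biUnion, Finset.mem_image, Finset.mem_filter]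
          exact ⟨a e, he.2, e, ⟨he.1, rfl⟩, rfl⟩
        have h4 := Finset.card_le_card h3
        rw [h1, h2] at h4
        exact Nat.le_of_mul_le_mul_left h4 (Nat.succ_pos m))
    have hsel : ∀ x, ∃ e : ε, x ∈ A → e ∈ S ∧ a e = x ∧ b e = f x := by
      have : Nonempty ε := by
        have := hft x₀ hx₀
        simp only [Finset.mem_image] at this
        exact ⟨this.choose⟩
      intro x
      by_cases hx : x ∈ A
      · have := hft x hx
        simp only [Finset.mem_image, Finset.mem_filter] at this
        obtain ⟨e, ⟨h1, h2⟩, h3⟩ := this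
        exact ⟨e, fun _ => ⟨h1, h2, h3⟩⟩
      · exact ⟨Classical.arbitrary ε, fun h => absurd h hx⟩
    choose s hs using hsel
    -- The matching also covers `B`, so removing it lowers all degrees by exactly one; it receives
    -- the new colour `m`.
    have hfB : A.image f = B := by
      apply Finset.eq_of_subset_of_card_le
      · intro y hy
        obtain ⟨x, hx, rfl⟩ := Finset.mem_image.1 hy
        rw [← (hs x hx).2.2]
        exact hB _ (hs x hx).1
      · rw [Finset.card_image_of_injOn hf, hAB]
    have hmem : ∀ e ∈ A.image s, e ∈ S ∧ s (a e) = e ∧ b e = f (a e) := by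
      intro e he
      obtain ⟨x, hx, rfl⟩ := Finset.mem_image.1 he
      obtain ⟨h1, h2, h3⟩ := hs x hx
      exact ⟨h1, by rw [h2], by rw [h2, h3]⟩
    obtain ⟨c, hc, hc'⟩ := ih (S \ A.image s)
      (fun e he => hA e (Finset.sdiff_subset he)) (fun e he => hB e (Finset.sdiff_subset he))
      (by
        intro x hx
        have : ({e ∈ S \ A.image s | a e = x} : Finset ε) = {e ∈ S | a e = x}.erase (s x) := by
          ext e
          simp only [Finset.mem_filter, Finset.mem_sdiff, Finset.mem_erase]
          constructor
          · rintro ⟨⟨h1, h2⟩, h3⟩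
            refine ⟨?_, h1, h3⟩
            rintro rfl
            exact h2 (Finset.mem_image_of_mem s hx)
          · rintro ⟨h1, h2, h3⟩
            refine ⟨⟨h2, fun h => h1 ?_⟩, h3⟩
            rw [← (hmem e h).2.1, h3]
        rw [this, Finset.card_erase_of_mem (by simp [(hs x hx).1, (hs x hx).2.1]), hAm x hx]
        rfl)
      (by
        intro y hy
        obtain ⟨x, hx, rfl⟩ := Finset.mem_image.1 (hfB.symm ▸ hy)
        have : ({e ∈ S \ A.image s | b e = f x} : Finset ε) =
            {e ∈ S | b e = f x}.erase (s x) := by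
          ext e
          simp only [Finset.mem_filter, Finset.mem_sdiff, Finset.mem_erase]
          constructor
          · rintro ⟨⟨h1, h2⟩, h3⟩
            refine ⟨?_, h1, h3⟩
            rintro rfl
            exact h2 (Finset.mem_image_of_mem s hx)
          · rintro ⟨h1, h2, h3⟩
            refine ⟨⟨h2, fun h => h1 ?_⟩, h3⟩
            obtain ⟨_, h4, h5⟩ := hmem e h
            rw [← h4, hf (hA e h2) hx (h5.symm.trans h3)]
        rw [this, Finset.card_erase_of_mem (by simp [(hs x hx).1, (hs x hx).2.2]), hBm _ hy]
        rfl)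
    refine ⟨fun e => if e ∈ A.image s then m else c e, fun e he => ?_, ?_⟩
    · by_cases h : e ∈ A.image s
      · simp only [h, if_true]; omega
      · simp only [h, if_false]
        have := hc e (Finset.mem_sdiff.2 ⟨he, h⟩)
        omega
    · intro e he e' he' hab hcc
      by_cases h : e ∈ A.image s <;> by_cases h' : e' ∈ A.image s
      · obtain ⟨_, h4, h5⟩ := hmem e h
        obtain ⟨_, h4', h5'⟩ := hmem e' h'
        have : a e = a e' := by
          rcases hab with hab | hab
          · exact hab
          · exact hf (hA e he) (hA e' he') (by rw [← h5, ← h5', hab])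
        rw [← h4, ← h4', this]
      · have := hc e' (Finset.mem_sdiff.2 ⟨he', h'⟩)
        simp only [h, h', if_true, if_false] at hcc
        omega
      · have := hc e (Finset.mem_sdiff.2 ⟨he, h⟩)
        simp only [h, h', if_true, if_false] at hcc
        omega
      · simp only [h, h', if_false] at hcc
        exact hc' e (Finset.mem_sdiff.2 ⟨he, h⟩) e' (Finset.mem_sdiff.2 ⟨he', h'⟩) hab hcc

/-! ### Menger's theorem in the form of an injective map. -/

namespace SimpleGraph

/-- Menger's theorem in functional form: if fewer than `|A|` vertices do not separate `A` from `B`,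
then some injective map moves the vertices of a finite subgraph along edges so that the orbits of
the vertices of `A` are disjoint paths to `B`. -/
theorem exists_injOn_of_forall_separator {W : Type*} [DecidableEq W] (H : SimpleGraph W)
    (A B : Finset W)
    (h : ∀ Y : Finset W, (∀ a ∈ A, ∀ b ∈ B, ∀ p : H.Walk a b, ∃ x ∈ p.support, x ∈ Y) →
      A.card ≤ Y.card) :
    ∃ W₁ : Finset W, ∀ W₀ : Finset W, W₁ ⊆ W₀ → ∃ f : W → W, Set.InjOn f (W₀ \ B : Finset W) ∧
      ∀ x ∈ W₀ \ B, f x ∈ W₀ \ A ∧ (f x = x ∨ H.Adj x (f x)) := by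
  classical
  -- Compactness: finitely many walks already force all hitting sets to be large, so Hall's theorem
  -- can be applied inside any finite vertex set that contains these walks.
  obtain ⟨𝒲, h𝒲, h𝒲'⟩ := exists_finite_subfamily_of_no_small_transversal A.card
    {S : Finset W | ∃ a ∈ A, ∃ b ∈ B, ∃ p : H.Walk a b, S = p.support.toFinset} (by
      intro Y hY
      refine h Y fun a ha b hb p => ?_
      obtain ⟨x, hx, hxY⟩ := hY _ ⟨a, ha, b, hb, p, rfl⟩
      exact ⟨x, by simpa using hx, hxY⟩)
  refine ⟨A ∪ 𝒲.biUnion id, fun W₀ hW₀ => ?_⟩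
  rcases isEmpty_or_nonempty W with hW | hW
  · exact ⟨id, fun x => hW.elim x, fun x => hW.elim x⟩
  obtain ⟨f, hf, hft⟩ := (W₀ \ B).exists_injOn_of_card_le_biUnion_card
    (fun x => {y ∈ W₀ \ A | y = x ∨ H.Adj x y}) (by
      intro S hS
      set N := S.biUnion fun x => {y ∈ W₀ \ A | y = x ∨ H.Adj x y} with hN
      have hmemN : ∀ y, y ∈ N ↔ ∃ x ∈ S, (y ∈ W₀ ∧ y ∉ A) ∧ (y = x ∨ H.Adj x y) := by
        intro y; simp [hN]
      have hSW : ∀ x ∈ S, x ∈ W₀ ∧ x ∉ B := fun x hx => Finset.mem_sdiff.1 (hS hx)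
      have hNS : N ∩ S = S \ A := by
        ext y
        simp only [Finset.mem_inter, Finset.mem_sdiff, hmemN]
        constructor
        · rintro ⟨⟨x, _, ⟨_, h⟩, _⟩, hy⟩; exact ⟨hy, h⟩
        · rintro ⟨hy, hyA⟩; exact ⟨⟨y, hy, ⟨(hSW y hy).1, hyA⟩, Or.inl rfl⟩, hy⟩
      -- A walk from `A` to `B` either starts in `A \ S` or leaves `S`, and then it does so through
      -- `A \ S` or `N \ S`. If `S` violated Hall's condition, this hitting set would have fewer
      -- than `|A|` elements.
      have hcard := h𝒲' ((A \ S) ∪ (N \ S)) (by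
        intro P hP
        obtain ⟨a, ha, b, hb, p, rfl⟩ := h𝒲 hP
        have hsub : ∀ x ∈ p.support, x ∈ W₀ := fun x hx => hW₀ (by
          simp only [Finset.mem_union, Finset.mem_biUnion]
          exact Or.inr ⟨_, hP, by simpa using hx⟩)
        by_cases haS : a ∈ S
        · obtain ⟨d, hd, hd1, hd2⟩ := p.exists_boundary_dart (S : Set W) haS
            (fun hbS => (hSW b hbS).2 hb)
          have hds := p.dart_snd_mem_support_of_mem_darts hd
          refine ⟨d.snd, by simpa using hds, ?_⟩
          rw [Finset.mem_coe] at hd1 hd2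
          by_cases hdA : d.snd ∈ A
          · exact Finset.mem_union_left _ (Finset.mem_sdiff.2 ⟨hdA, hd2⟩)
          · exact Finset.mem_union_right _ (Finset.mem_sdiff.2
              ⟨(hmemN _).2 ⟨d.fst, hd1, ⟨hsub _ hds, hdA⟩, Or.inr d.adj⟩, hd2⟩)
        · exact ⟨a, by simp, by simp [ha, haS]⟩)
      have h1 := Finset.card_union_le (A \ S) (N \ S)
      have h2 := Finset.card_sdiff_add_card_inter A S
      have h3 := Finset.card_sdiff_add_card_inter N S
      have h4 := Finset.card_sdiff_add_card_inter S A
      rw [hNS] at h3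
      rw [Finset.inter_comm S A] at h4
      omega)
  refine ⟨f, hf, fun x hx => ?_⟩
  have := hft x hx
  rw [Finset.mem_filter] at this
  exact this

end SimpleGraph

/-! ### Linkages, encoded as orbits of an injective map. -/

namespace SimpleGraph

variable {V : Type*}

/-- The orbits of the points of `Z` under `h`, followed through `L` until they reach `Z'`, are
disjoint paths of `H` from `Z` to `Z'`, and `L` is the set of their vertices outside `Z'`. -/
structure IsLinkage (H : SimpleGraph V) (Z Z' L : Set V) (h : V → V) : Prop where
  finite : L.Finite
  source_subset : Z ⊆ L
  disjoint : Disjoint L Z'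
  mapsTo : ∀ x ∈ L, h x ∈ L ∨ h x ∈ Z'
  notMem_source : ∀ x ∈ L, h x ∉ Z
  injOn : Set.InjOn h L
  adj : ∀ x ∈ L, H.Adj x (h x)
  forward_induction : ∀ P : V → Prop, (∀ z ∈ Z, P z) → (∀ x ∈ L, P x → h x ∈ L → P (h x)) →
    ∀ x ∈ L, P x

/-- The edges of a linkage. -/
def linkageEdges (L : Set V) (h : V → V) : Set (Sym2 V) := (fun x => s(x, h x)) '' L

/-- Restricting `f` to what is reached from `Z` discards its fixed points: no vertex of `Z` is
fixed, and by injectivity a fixed point can only be reached from itself. -/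
theorem exists_isLinkage_of_injOn (H : SimpleGraph V) {Z Z' D : Set V} {f : V → V}
    (hD : D.Finite) (hZ : Z ⊆ D) (hdisj : Disjoint D Z') (hf : Set.InjOn f D)
    (hmaps : ∀ x ∈ D, f x ∈ D ∨ f x ∈ Z') (hnot : ∀ x ∈ D, f x ∉ Z)
    (hadj : ∀ x ∈ D, f x = x ∨ H.Adj x (f x)) :
    ∃ L ⊆ D, H.IsLinkage Z Z' L f := by
  let L : Set V := {x | ∀ S : Set V, Z ⊆ S → (∀ y ∈ S, y ∈ D → f y ∈ D → f y ∈ S) → x ∈ S}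
  have hLD : L ⊆ D := fun x hx => hx D hZ fun _ _ _ h => h
  have hstep : ∀ x ∈ L, f x ∈ D → f x ∈ L := fun x hx hfx S hS hS' =>
    hS' x (hx S hS hS') (hLD hx) hfx
  have hind : ∀ P : V → Prop, (∀ z ∈ Z, P z) → (∀ x ∈ L, P x → f x ∈ L → P (f x)) →
      ∀ x ∈ L, P x := by
    intro P h1 h2 x hx
    refine (hx {y | y ∈ L ∧ P y} (fun z hz => ⟨fun S hS _ => hS hz, h1 z hz⟩) ?_).2
    rintro y ⟨hy, hPy⟩ _ hfy
    exact ⟨hstep y hy hfy, h2 y hy hPy (hstep y hy hfy)⟩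
  have hne : ∀ x ∈ L, f x ≠ x := by
    refine hind _ (fun z hz h => hnot z (hZ hz) (h.symm ▸ hz)) fun x hx h hfx h' => h ?_
    exact hf (hLD hfx) (hLD hx) h'
  refine ⟨L, hLD, hD.subset hLD, fun z hz S hS _ => hS hz, hdisj.mono_left hLD, ?_,
    fun x hx => hnot x (hLD hx), hf.mono hLD, ?_, hind⟩
  · intro x hx
    exact (hmaps x (hLD hx)).imp (hstep x hx) id
  · intro x hx
    exact (hadj x (hLD hx)).resolve_left (hne x hx)

namespace IsLinkage

variable {H : SimpleGraph V} {Z Z' L : Set V} {h : V → V}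

/-- Finiteness excludes cycles and endless orbits: a nonempty set of counterexamples would be
permuted by `h`, whereas orbits start in `Z`, which `h` never hits. In particular, every orbit ends
in `Z'`. -/
theorem backward_induction (hL : H.IsLinkage Z Z' L h) (P : V → Prop) (h1 : ∀ z ∈ Z', P z)
    (h2 : ∀ x ∈ L, P (h x) → P x) : ∀ x ∈ L, P x := by
  let Bad : Set V := {x | x ∈ L ∧ ¬ P x}
  have hBad : Bad.Finite := hL.finite.subset fun x hx => hx.1
  have hmaps : Set.MapsTo h Bad Bad := by
    rintro x ⟨hx, hPx⟩
    have hP : ¬ P (h x) := fun hP => hPx (h2 x hx hP)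
    exact ⟨(hL.mapsTo x hx).resolve_right fun hz => hP (h1 _ hz), hP⟩
  have hsurj : Set.SurjOn h Bad Bad := by
    have := hBad.injOn_iff_bijOn_of_mapsTo hmaps
    exact (this.1 (hL.injOn.mono fun x hx => hx.1)).surjOn
  have key : ∀ x ∈ L, x ∉ Bad := by
    refine hL.forward_induction _ ?_ ?_
    · intro z hz hzB
      obtain ⟨y, hy, rfl⟩ := hsurj hzB
      exact hL.notMem_source y hy.1 hz
    · intro x hx hxB _ hhx
      obtain ⟨y, hy, hyx⟩ := hsurj hhx
      exact hxB (hL.injOn hy.1 hx hyx ▸ hy)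
  intro x hx
  by_contra hP
  exact key x hx ⟨hx, hP⟩

theorem exists_iterate_mem (hL : H.IsLinkage Z Z' L h) : ∀ x ∈ L,
    ∃ k, h^[k] x ∈ Z' ∧ ∀ j < k, h^[j] x ∈ L := by
  refine fun x hx => hL.backward_induction
    (fun x => ∃ k, h^[k] x ∈ Z' ∧ ∀ j < k, h^[j] x ∈ L) ?_ ?_ x hx
  · exact fun z hz => ⟨0, hz, by simp⟩
  · rintro x hx ⟨k, hk, hk'⟩
    refine ⟨k + 1, hk, fun j hj => ?_⟩
    cases j with
    | zero => exact hx
    | succ j => exact hk' j (by omega)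

theorem iterate_injOn (hL : H.IsLinkage Z Z' L h) (k : ℕ) : ∀ x y : V,
    (∀ j < k, h^[j] x ∈ L) → (∀ j < k, h^[j] y ∈ L) → h^[k] x = h^[k] y → x = y := by
  induction k with
  | zero => exact fun x y _ _ h => h
  | succ k ih =>
    intro x y hx hy hxy
    rw [Function.iterate_succ_apply', Function.iterate_succ_apply'] at hxy
    exact ih x y (fun j hj => hx j (by omega)) (fun j hj => hy j (by omega))
      (hL.injOn (hx k (by omega)) (hy k (by omega)) hxy)

theorem reachable_iterate (k : ℕ) : ∀ x : V, (∀ j < k, h^[j] x ∈ L) →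
    (fromEdgeSet (linkageEdges L h)).Reachable x (h^[k] x) := by
  induction k with
  | zero => exact fun x _ => Reachable.refl x
  | succ k ih =>
    intro x hx
    refine (ih x fun j hj => hx j (by omega)).trans ?_
    rw [Function.iterate_succ_apply']
    by_cases he : h^[k] x = h (h^[k] x)
    · rw [← he]
    · exact Adj.reachable ((fromEdgeSet_adj _).2 ⟨⟨_, hx k (by omega), rfl⟩, he⟩)

/-- Distinct starting points are linked to distinct endpoints. -/
theorem exists_reachable_ne (hL : H.IsLinkage Z Z' L h) {z₀ z₁ : V} (h₀ : z₀ ∈ Z) (h₁ : z₁ ∈ Z)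
    (hne : z₀ ≠ z₁) : ∃ a ∈ Z', ∃ b ∈ Z', a ≠ b ∧
      (fromEdgeSet (linkageEdges L h)).Reachable z₀ a ∧
      (fromEdgeSet (linkageEdges L h)).Reachable z₁ b := by
  have key : ∀ z₀ ∈ Z, ∀ z₁ ∈ Z, z₀ ≠ z₁ → ∀ k n, (∀ j < k, h^[j] z₀ ∈ L) →
      (∀ j < k + n, h^[j] z₁ ∈ L) → h^[k] z₀ ≠ h^[k + n] z₁ := by
    intro z₀ h₀ z₁ h₁ hne k n hk hn he
    rw [Function.iterate_add_apply] at he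
    have := hL.iterate_injOn k z₀ (h^[n] z₁) hk (fun j hj => by
      rw [← Function.iterate_add_apply]; exact hn _ (by omega)) he
    cases n with
    | zero => exact hne this
    | succ n =>
      rw [Function.iterate_succ_apply'] at this
      exact hL.notMem_source _ (hn n (by omega)) (this ▸ h₀)
  obtain ⟨k, hk, hk'⟩ := hL.exists_iterate_mem z₀ (hL.source_subset h₀)
  obtain ⟨n, hn, hn'⟩ := hL.exists_iterate_mem z₁ (hL.source_subset h₁)
  refine ⟨_, hk, _, hn, ?_, reachable_iterate k z₀ hk', reachable_iterate n z₁ hn'⟩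
  rcases le_total k n with hkn | hkn
  · obtain ⟨n, rfl⟩ := Nat.exists_eq_add_of_le hkn
    exact key z₀ h₀ z₁ h₁ hne k n hk' hn'
  · obtain ⟨k, rfl⟩ := Nat.exists_eq_add_of_le hkn
    exact (key z₁ h₁ z₀ h₀ hne.symm n k hn' hk').symm

theorem exists_reachable (hL : H.IsLinkage Z Z' L h) {x : V} (hx : x ∈ L) :
    ∃ a ∈ Z', (fromEdgeSet (linkageEdges L h)).Reachable x a := by
  obtain ⟨k, hk, hk'⟩ := hL.exists_iterate_mem x hx
  exact ⟨_, hk, reachable_iterate k x hk'⟩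

end IsLinkage

/-! ### Edge-disjoint linkages from Menger's theorem in a blown-up graph. -/

/-- The graph obtained from `H` by replacing every vertex by `m` copies and subdividing all
edges. -/
def blowUp (H : SimpleGraph V) (m : ℕ) : SimpleGraph (V × Fin m ⊕ Sym2 V) :=
  fromRel fun x y => ∃ v i e, x = Sum.inl (v, i) ∧ y = Sum.inr e ∧ e ∈ H.edgeSet ∧ v ∈ e

theorem blowUp_adj_inl_inr {H : SimpleGraph V} {m : ℕ} {v : V} {i : Fin m} {e : Sym2 V} :
    (H.blowUp m).Adj (Sum.inl (v, i)) (Sum.inr e) ↔ e ∈ H.edgeSet ∧ v ∈ e := by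
  simp [blowUp]

theorem blowUp_not_adj_inl_inl {H : SimpleGraph V} {m : ℕ} {x y : V × Fin m} :
    ¬ (H.blowUp m).Adj (Sum.inl x) (Sum.inl y) := by
  simp [blowUp]

theorem blowUp_not_adj_inr_inr {H : SimpleGraph V} {m : ℕ} {x y : Sym2 V} :
    ¬ (H.blowUp m).Adj (Sum.inr x) (Sum.inr y) := by
  simp [blowUp]

/-- A set `Y` in the blow-up blocks a vertex of `H` only if it contains all `m` copies. Thus
vertices have capacity `m` and edges have capacity 1. -/
theorem exists_blowUp_walk {H : SimpleGraph V} {m : ℕ} (Y : Finset (V × Fin m ⊕ Sym2 V))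
    {a b : V} (p : H.Walk a b) (hV : ∀ v ∈ p.support, ∃ i, Sum.inl (v, i) ∉ Y)
    (hE : ∀ e ∈ p.edges, Sum.inr e ∉ Y) :
    ∀ i, Sum.inl (a, i) ∉ Y → ∃ j, ∃ q : (H.blowUp m).Walk (Sum.inl (a, i)) (Sum.inl (b, j)),
      ∀ x ∈ q.support, x ∉ Y := by
  induction p with
  | nil => exact fun i hi => ⟨i, Walk.nil, by simpa using hi⟩
  | @cons u v w huv p ih =>
    intro i hi
    obtain ⟨j, hj⟩ := hV v (by simp)
    obtain ⟨k, q, hq⟩ := ih (fun x hx => hV x (by simp [hx])) (fun e he => hE e (by simp [he])) j hj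
    have h1 : (H.blowUp m).Adj (Sum.inl (u, i)) (Sum.inr s(u, v)) :=
      blowUp_adj_inl_inr.2 ⟨huv, by simp⟩
    have h2 : (H.blowUp m).Adj (Sum.inr s(u, v)) (Sum.inl (v, j)) :=
      (blowUp_adj_inl_inr.2 ⟨huv, by simp⟩).symm
    refine ⟨k, Walk.cons h1 (Walk.cons h2 q), fun x hx => ?_⟩
    simp only [Walk.support_cons, List.mem_cons] at hx
    rcases hx with rfl | rfl | hx
    · exact hi
    · exact hE _ (by simp)
    · exact hq x hx

/-- If the sets of `|Y|` vertices and `|F|` edges that separate `Z` from `Z'` all satisfy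
`m * |Z| ≤ m * |Y| + |F|`, then there are `m` edge-disjoint linkages from `Z` to `Z'`. -/
theorem exists_edgeDisjoint_linkages (H : SimpleGraph V) (Z Z' : Finset V) (hd : Disjoint Z Z')
    (m : ℕ) (hm : m = 1 ∨ Z.card = Z'.card)
    (hcut : ∀ (Y : Finset V) (F : Finset (Sym2 V)),
      (∀ a ∈ Z, ∀ b ∈ Z', ∀ p : H.Walk a b, (∃ x ∈ p.support, x ∈ Y) ∨ ∃ e ∈ p.edges, e ∈ F) →
      m * Z.card ≤ m * Y.card + F.card) :
    ∃ (L : Fin m → Set V) (h : Fin m → V → V), (∀ i, H.IsLinkage Z Z' (L i) (h i)) ∧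
      ∀ i j, i ≠ j → Disjoint (linkageEdges (L i) (h i)) (linkageEdges (L j) (h j)) := by
  classical
  rcases Nat.eq_zero_or_pos m with rfl | hm0
  · exact ⟨fun _ => ∅, fun _ => id, fun i => i.elim0, fun i => i.elim0⟩
  let A : Finset (V × Fin m ⊕ Sym2 V) := (Z ×ˢ Finset.univ).map Function.Embedding.inl
  let B : Finset (V × Fin m ⊕ Sym2 V) := (Z' ×ˢ Finset.univ).map Function.Embedding.inl
  have hA : ∀ v i, Sum.inl (v, i) ∈ A ↔ v ∈ Z := by simp [A]
  have hB : ∀ v i, Sum.inl (v, i) ∈ B ↔ v ∈ Z' := by simp [B]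
  have hBr : ∀ e, Sum.inr e ∉ B := by simp [B]
  obtain ⟨W₁, hW₁⟩ := (H.blowUp m).exists_injOn_of_forall_separator A B (by
    intro Y hY
    let YV : Finset V := {v ∈ Y.biUnion (fun x => x.elim (fun p => {p.1}) fun _ => ∅) |
      ∀ i, Sum.inl (v, i) ∈ Y}
    let F : Finset (Sym2 V) := Y.biUnion (fun x => x.elim (fun _ => ∅) fun e => {e})
    have hF : ∀ e, e ∈ F ↔ Sum.inr e ∈ Y := by simp [F]
    have hYV : ∀ v ∈ YV, ∀ i, Sum.inl (v, i) ∈ Y := fun v hv => (Finset.mem_filter.1 hv).2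
    have hYV' : ∀ v, v ∉ YV → ∃ i, Sum.inl (v, i) ∉ Y := by
      intro v hv
      by_contra! hall
      refine hv (Finset.mem_filter.2 ⟨?_, hall⟩)
      simp only [Finset.mem_biUnion]
      exact ⟨_, hall ⟨0, hm0⟩, by simp⟩
    have hcardA : A.card = m * Z.card := by simp [A, mul_comm]
    have hle : m * YV.card + F.card ≤ Y.card := by
      have h1 : ((YV ×ˢ (Finset.univ : Finset (Fin m))).disjSum F).card = m * YV.card + F.card := by
        simp [Finset.card_disjSum, mul_comm]
      rw [← h1]
      refine Finset.card_le_card ?_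
      intro x hx
      rw [Finset.mem_disjSum] at hx
      rcases hx with ⟨⟨v, i⟩, hv, rfl⟩ | ⟨e, he, rfl⟩
      · exact hYV v (Finset.mem_product.1 hv).1 i
      · exact (hF e).1 he
    rw [hcardA]
    refine (hcut YV F ?_).trans hle
    intro a ha b hb p
    by_contra! hno
    obtain ⟨hno1, hno2⟩ := hno
    obtain ⟨i, hi⟩ := hYV' a (hno1 a (by simp))
    obtain ⟨j, q, hq⟩ := exists_blowUp_walk Y p (fun v hv => hYV' v (hno1 v hv))
      (fun e he h => hno2 e he ((hF e).2 h)) i hi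
    obtain ⟨x, hx, hxY⟩ := hY _ ((hA a i).2 ha) _ ((hB b j).2 hb) q
    exact hq x hx hxY)
  let V₀ : Finset V := Z ∪ Z' ∪ W₁.biUnion fun x => x.elim (fun p => {p.1}) fun _ => ∅
  let E₀ : Finset (Sym2 V) := W₁.biUnion fun x => x.elim (fun _ => ∅) fun e => {e}
  let W₀ : Finset (V × Fin m ⊕ Sym2 V) := (V₀ ×ˢ Finset.univ).disjSum E₀
  have hW₀V : ∀ v i, Sum.inl (v, i) ∈ W₀ ↔ v ∈ V₀ := by simp [W₀]
  obtain ⟨f, hf, hf'⟩ := hW₁ W₀ (by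
    rintro (⟨v, i⟩ | e) hx
    · rw [hW₀V]
      refine Finset.mem_union_right _ (Finset.mem_biUnion.2 ⟨_, hx, by simp⟩)
    · simp only [W₀, Finset.inr_mem_disjSum]
      exact Finset.mem_biUnion.2 ⟨_, hx, by simp⟩)
  let S : Finset (V × Fin m) := (V₀ \ Z') ×ˢ Finset.univ
  have hS : ∀ x : V × Fin m, x ∈ S ↔ x.1 ∈ V₀ ∧ x.1 ∉ Z' := by simp [S]
  have hSdom : ∀ x ∈ S, Sum.inl x ∈ W₀ \ B := by
    rintro ⟨v, i⟩ hx
    rw [hS] at hx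
    rw [Finset.mem_sdiff, hW₀V, hB]
    exact hx
  have hE : ∀ x ∈ S, ∀ e, f (Sum.inl x) = Sum.inr e →
      Sum.inr e ∈ W₀ \ B ∧ e ∈ H.edgeSet ∧ x.1 ∈ e := by
    rintro ⟨v, i⟩ hx e he
    obtain ⟨h1, h2⟩ := hf' _ (hSdom _ hx)
    rw [he] at h1 h2
    have h3 := blowUp_adj_inl_inr.1 (h2.resolve_left (by simp))
    exact ⟨Finset.mem_sdiff.2 ⟨(Finset.mem_sdiff.1 h1).1, hBr e⟩, h3⟩
  have key : ∀ x ∈ S, ∃ y : V × Fin m, y.1 ∈ V₀ \ Z ∧ ((f (Sum.inl x) = Sum.inl x ∧ y = x) ∨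
      ∃ e, f (Sum.inl x) = Sum.inr e ∧ f (Sum.inr e) = Sum.inl y ∧ e ∈ H.edgeSet ∧
        x.1 ∈ e ∧ y.1 ∈ e) := by
    intro x hx
    obtain ⟨h1, h2⟩ := hf' _ (hSdom x hx)
    rcases hfx : f (Sum.inl x) with y | e
    · rw [hfx] at h1 h2
      have hyx : y = x := by
        rcases h2 with h2 | h2
        · exact Sum.inl_injective h2
        · exact absurd h2 blowUp_not_adj_inl_inl
      subst hyx
      obtain ⟨v, i⟩ := y
      rw [Finset.mem_sdiff, hW₀V, hA] at h1
      exact ⟨(v, i), Finset.mem_sdiff.2 h1, Or.inl ⟨rfl, rfl⟩⟩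
    · obtain ⟨h3, h4, h5⟩ := hE x hx e hfx
      obtain ⟨h6, h7⟩ := hf' _ h3
      -- A fixed subdivision vertex would be the image of both itself and the copy `x`, contrary to
      -- injectivity.
      have hne : f (Sum.inr e) ≠ Sum.inr e := by
        intro h
        have := hf h3 (hSdom x hx) (h.trans hfx.symm)
        simp at this
      rcases hfe : f (Sum.inr e) with y | e'
      · obtain ⟨w, j⟩ := y
        rw [hfe] at h6 h7
        rw [Finset.mem_sdiff, hW₀V, hA] at h6
        refine ⟨(w, j), Finset.mem_sdiff.2 h6, Or.inr ⟨e, rfl, hfe, h4, h5, ?_⟩⟩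
        exact (blowUp_adj_inl_inr.1 (h7.resolve_left (by simp)).symm).2
      · rw [hfe] at h7 hne
        exact absurd (h7.resolve_left hne) blowUp_not_adj_inr_inr
  choose! g hg hg' using key
  have hginj : Set.InjOn g S := by
    intro x hx y hy hxy
    rcases hg' x hx with ⟨h1, h2⟩ | ⟨e, h1, h2, -, -, -⟩ <;>
      rcases hg' y hy with ⟨h3, h4⟩ | ⟨e', h3, h4, -, -, -⟩
    · rw [← h2, hxy, h4]
    · have := hf (hSdom x hx) (hE y hy e' h3).1 (by rw [h1, h4, ← hxy, h2])
      simp at this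
    · have := hf (hSdom y hy) (hE x hx e h1).1 (by rw [h3, h2, hxy, h4])
      simp at this
    · have h5 := hf (hE x hx e h1).1 (hE y hy e' h3).1 (by rw [h2, h4, hxy])
      have h6 := hf (hSdom x hx) (hSdom y hy) (by rw [h1, h3, h5])
      exact Sum.inl_injective h6
  -- Regard each copy `x` in `S` as an edge from `x.1` to `(g x).1` of a bipartite multigraph. A
  -- colour class of a proper colouring with `m` colours is an injective map on vertices, which
  -- gives one linkage.
  have hcol : ∃ c : V × Fin m → ℕ, (∀ x ∈ S, c x < m) ∧
      ∀ x ∈ S, ∀ y ∈ S, x.1 = y.1 ∨ (g x).1 = (g y).1 → c x = c y → x = y := by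
    rcases hm with rfl | hZZ
    · refine ⟨fun _ => 0, fun _ _ => Nat.one_pos, fun x hx y hy hxy _ => ?_⟩
      rcases hxy with h | h
      · exact Prod.ext h (Subsingleton.elim _ _)
      · exact hginj hx hy (Prod.ext h (Subsingleton.elim _ _))
    -- As `Z` and `Z'` have equal size, `g` is onto all copies of `V₀ \ Z`; this makes the
    -- multigraph `m`-regular on both sides.
    · have hgimg : S.image g = (V₀ \ Z) ×ˢ Finset.univ := by
        apply Finset.eq_of_subset_of_card_le
        · intro y hy
          obtain ⟨x, hx, rfl⟩ := Finset.mem_image.1 hy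
          exact Finset.mem_product.2 ⟨hg x hx, by simp⟩
        · rw [Finset.card_image_of_injOn hginj]
          simp only [S, Finset.card_product]
          rw [Finset.card_sdiff_of_subset (by intro z hz; simp [V₀, hz]),
            Finset.card_sdiff_of_subset (by intro z hz; simp [V₀, hz]), hZZ]
      refine exists_proper_edge_colouring Prod.fst (fun x => (g x).1) (V₀ \ Z') (V₀ \ Z) m S
        (fun x hx => (Finset.mem_product.1 hx).1) hg ?_ ?_
      · intro v hv
        have : ({x ∈ S | x.1 = v} : Finset (V × Fin m)) = {v} ×ˢ Finset.univ := by
          ext x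
          simp only [Finset.mem_filter, hS, Finset.mem_product, Finset.mem_singleton,
            Finset.mem_univ, and_true]
          rw [Finset.mem_sdiff] at hv
          constructor
          · exact fun h => h.2
          · rintro rfl; exact ⟨hv, rfl⟩
        rw [this]
        simp
      · intro w hw
        have : ({x ∈ S | (g x).1 = w} : Finset (V × Fin m)).image g = {w} ×ˢ Finset.univ := by
          ext y
          simp only [Finset.mem_image, Finset.mem_filter, Finset.mem_product,
            Finset.mem_singleton, Finset.mem_univ, and_true]
          constructor
          · rintro ⟨x, ⟨_, h⟩, rfl⟩; exact h
          · rintro rfl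
            have : y ∈ S.image g := by
              rw [hgimg]; exact Finset.mem_product.2 ⟨hw, Finset.mem_univ _⟩
            obtain ⟨x, hx, rfl⟩ := Finset.mem_image.1 this
            exact ⟨x, ⟨hx, rfl⟩, rfl⟩
        rw [← Finset.card_image_of_injOn (f := g) (hginj.mono (fun x hx =>
          (Finset.mem_filter.1 hx).1)), this]
        simp
  obtain ⟨c, hc, hc'⟩ := hcol
  have hsel : ∀ (i : Fin m) (v : V), ∃ j : Fin m, v ∈ V₀ \ Z' → c (v, j) = i := by
    intro i v
    by_cases hv : v ∈ V₀ \ Z'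
    · have hvS : ∀ j, (v, j) ∈ S := fun j => (hS _).2 (Finset.mem_sdiff.1 hv)
      have hinj : Function.Injective fun j : Fin m => (⟨c (v, j), hc _ (hvS j)⟩ : Fin m) := by
        intro j j' hjj
        have := hc' _ (hvS j) _ (hvS j') (Or.inl rfl) (by simpa using hjj)
        simpa using this
      obtain ⟨j, hj⟩ := (Finite.injective_iff_surjective.1 hinj) i
      exact ⟨j, fun _ => congrArg Fin.val hj⟩
    · exact ⟨i, fun h => absurd h hv⟩
  choose s hs using hsel
  let h : Fin m → V → V := fun i v => (g (v, s i v)).1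
  have hsS : ∀ i, ∀ v ∈ V₀ \ Z', (v, s i v) ∈ S := fun i v hv => (hS _).2 (Finset.mem_sdiff.1 hv)
  have hmove : ∀ i, ∀ v ∈ V₀ \ Z', h i v = v ∨
      (H.Adj v (h i v) ∧ f (Sum.inl (v, s i v)) = Sum.inr s(v, h i v)) := by
    intro i v hv
    rcases hg' _ (hsS i v hv) with ⟨_, h2⟩ | ⟨e, h1, h2, h3, h4, h5⟩
    · left
      simp only [h, h2]
    · by_cases hvw : h i v = v
      · exact Or.inl hvw
      · right
        have he : e = s(v, h i v) := ((Sym2.mem_and_mem_iff (Ne.symm hvw)).1 ⟨h4, h5⟩)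
        rw [← he]
        refine ⟨?_, h1⟩
        rw [he] at h3
        exact h3
  have hlink : ∀ i, ∃ L ⊆ ((V₀ \ Z' : Finset V) : Set V), H.IsLinkage Z Z' L (h i) := by
    intro i
    apply exists_isLinkage_of_injOn
    · exact Finset.finite_toSet _
    · intro z hz
      rw [Finset.mem_coe, Finset.mem_sdiff]
      exact ⟨by simp [V₀, Finset.mem_coe.1 hz], Finset.disjoint_left.1 hd hz⟩
    · rw [Set.disjoint_left]
      intro x hx hxZ
      exact (Finset.mem_sdiff.1 hx).2 hxZ
    · intro x hx y hy hxy
      have := hc' _ (hsS i x hx) _ (hsS i y hy) (Or.inr hxy)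
        ((hs i x hx).trans (hs i y hy).symm)
      exact congrArg Prod.fst this
    · intro x hx
      have h1 : h i x ∈ V₀ := (Finset.mem_sdiff.1 (hg _ (hsS i x hx))).1
      by_cases h2 : h i x ∈ Z'
      · exact Or.inr h2
      · exact Or.inl (Finset.mem_sdiff.2 ⟨h1, h2⟩)
    · exact fun x hx => (Finset.mem_sdiff.1 (hg _ (hsS i x hx))).2
    · exact fun x hx => (hmove i x hx).imp id And.left
  choose L hLsub hL using hlink
  refine ⟨L, h, hL, fun i j hij => Set.disjoint_left.2 ?_⟩
  rintro _ ⟨x, hx, rfl⟩ ⟨y, hy, hxy⟩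
  have hx' := hLsub i hx
  have hy' := hLsub j hy
  have h1 := ((hmove i x hx').resolve_left ((hL i).adj x hx).ne').2
  have h2 := ((hmove j y hy').resolve_left ((hL j).adj y hy).ne').2
  -- A subdivision vertex has at most one preimage under `f`, so an edge shared by two linkages
  -- comes from one copy, which has one colour.
  have h3 := Sum.inl_injective (hf (hSdom _ (hsS i x hx')) (hSdom _ (hsS j y hy'))
    (by rw [h1, h2]; exact congrArg Sum.inr hxy.symm))
  apply hij
  ext
  rw [← hs i x hx', ← hs j y hy', h3]

end SimpleGraph

/-! ### Rays and double rays assembled from linkages. -/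

namespace SimpleGraph

variable {V : Type*} {G : SimpleGraph V}

theorem IsLinkage.mono {H H' : SimpleGraph V} {Z Z' L : Set V} {h : V → V} (hH : H ≤ H')
    (hL : H.IsLinkage Z Z' L h) : H'.IsLinkage Z Z' L h :=
  { hL with adj := fun x hx => hH (hL.adj x hx) }

theorem IsLinkage.linkageEdges_subset {Z Z' L : Set V} {h : V → V}
    (hL : G.IsLinkage Z Z' L h) : linkageEdges L h ⊆ G.edgeSet := by
  rintro _ ⟨x, hx, rfl⟩
  exact hL.adj x hx

theorem Ray.edges_subset (R : G.Ray) : R.edges ⊆ G.edgeSet := by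
  rintro _ ⟨i, rfl⟩
  exact R.adj i

/-- Concatenating consecutive linkages yields disjoint rays. -/
theorem exists_rays_of_linkages (Z L : ℕ → Set V) (h : ℕ → V → V)
    (hL : ∀ n, G.IsLinkage (Z n) (Z (n + 1)) (L n) (h n))
    (hdisj : ∀ n k, n ≠ k → Disjoint (L n) (L k)) :
    ∃ ρ : Z 0 → G.Ray, (∀ z, (ρ z).edges ⊆ ⋃ n, linkageEdges (L n) (h n)) ∧
      (∀ z, (ρ z).vertex 0 = z) ∧ (∀ z n, ∃ t, (ρ z).vertex t ∈ Z n) ∧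
      ∀ z z', z ≠ z' → Disjoint (ρ z).verts (ρ z').verts := by
  classical
  have huniq : ∀ {n k x}, x ∈ L n → x ∈ L k → n = k := by
    intro n k x hn hk
    by_contra hne
    exact Set.disjoint_left.1 (hdisj n k hne) hn hk
  have hZL : ∀ n, Z n ⊆ L n := fun n => (hL n).source_subset
  let g : V → V := fun x => if hx : ∃ n, x ∈ L n then h hx.choose x else x
  have hg : ∀ n, ∀ x ∈ L n, g x = h n x := by
    intro n x hx
    have hex : ∃ n, x ∈ L n := ⟨n, hx⟩
    have : hex.choose = n := huniq hex.choose_spec hx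
    simp only [g, hex, dite_true, this]
  let D : Set V := ⋃ n, L n
  have hmaps : ∀ x ∈ D, g x ∈ D := by
    intro x hx
    obtain ⟨n, hn⟩ := Set.mem_iUnion.1 hx
    rw [hg n x hn]
    rcases (hL n).mapsTo x hn with h1 | h1
    · exact Set.mem_iUnion.2 ⟨n, h1⟩
    · exact Set.mem_iUnion.2 ⟨n + 1, hZL _ h1⟩
  -- The image of level `n` lies in `L n` or in `Z (n + 1)`, a part of `L (n + 1)` that the map of
  -- level `n + 1` never hits. Hence images of different levels cannot coincide.
  have hlevel : ∀ n k x y, x ∈ L n → y ∈ L k → g x = g y → n = k := by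
    have aux : ∀ n k x y, x ∈ L n → y ∈ L k → h n x = h k y → h n x ∈ L n → n = k := by
      intro n k x y hx hy hxy h1
      rcases (hL k).mapsTo y hy with h2 | h2
      · exact huniq h1 (hxy ▸ h2)
      · have : n = k + 1 := huniq h1 (hxy ▸ hZL _ h2)
        subst this
        exact absurd (hxy ▸ h2) ((hL (k + 1)).notMem_source x hx)
    intro n k x y hx hy hxy
    rw [hg n x hx, hg k y hy] at hxy
    rcases (hL n).mapsTo x hx with h1 | h1
    · exact aux n k x y hx hy hxy h1
    · rcases (hL k).mapsTo y hy with h2 | h2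
      · exact (aux k n y x hy hx hxy.symm h2).symm
      · have := huniq (hZL _ h1) (hxy ▸ hZL _ h2)
        omega
  have hinj : Set.InjOn g D := by
    intro x hx y hy hxy
    obtain ⟨n, hn⟩ := Set.mem_iUnion.1 hx
    obtain ⟨k, hk⟩ := Set.mem_iUnion.1 hy
    obtain rfl := hlevel n k x y hn hk hxy
    rw [hg n x hn, hg n y hk] at hxy
    exact (hL n).injOn hn hk hxy
  have hnot : ∀ x ∈ D, g x ∉ Z 0 := by
    intro x hx h0
    obtain ⟨n, hn⟩ := Set.mem_iUnion.1 hx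
    rw [hg n x hn] at h0
    rcases (hL n).mapsTo x hn with h1 | h1
    · obtain rfl := huniq h1 (hZL 0 h0)
      exact (hL 0).notMem_source x hn h0
    · have := huniq (hZL _ h1) (hZL 0 h0)
      omega
  have hiter : ∀ z ∈ Z 0, ∀ t, g^[t] z ∈ D := by
    intro z hz t
    induction t with
    | zero => exact Set.mem_iUnion.2 ⟨0, hZL 0 hz⟩
    | succ t ih => rw [Function.iterate_succ_apply']; exact hmaps _ ih
  have hcancel : ∀ z ∈ Z 0, ∀ z' ∈ Z 0, ∀ s t, g^[s] z = g^[t] z' → s = t ∧ z = z' := by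
    intro z hz z' hz' s
    induction s with
    | zero =>
      intro t hst
      cases t with
      | zero => exact ⟨rfl, hst⟩
      | succ t =>
        rw [Function.iterate_succ_apply'] at hst
        exact absurd (show g (g^[t] z') ∈ Z 0 from hst ▸ hz) (hnot _ (hiter z' hz' t))
    | succ s ih =>
      intro t hst
      cases t with
      | zero =>
        rw [Function.iterate_succ_apply'] at hst
        exact absurd (show g (g^[s] z) ∈ Z 0 from hst ▸ hz') (hnot _ (hiter z hz s))
      | succ t =>
        rw [Function.iterate_succ_apply', Function.iterate_succ_apply'] at hst
        obtain ⟨h1, h2⟩ := ih t (hinj (hiter z hz s) (hiter z' hz' t) hst)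
        exact ⟨by rw [h1], h2⟩
  have hedge : ∀ z ∈ Z 0, ∀ t, ∃ n, g^[t] z ∈ L n ∧ g^[t + 1] z = h n (g^[t] z) := by
    intro z hz t
    obtain ⟨n, hn⟩ := Set.mem_iUnion.1 (hiter z hz t)
    exact ⟨n, hn, by rw [Function.iterate_succ_apply', hg n _ hn]⟩
  refine ⟨fun z => ⟨fun t => g^[t] z.1, fun s t hst => (hcancel _ z.2 _ z.2 s t hst).1, ?_⟩,
    ?_, fun z => rfl, ?_, ?_⟩
  · intro t
    obtain ⟨n, hn, he⟩ := hedge z z.2 t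
    rw [he]
    exact (hL n).adj _ hn
  · rintro z _ ⟨t, rfl⟩
    obtain ⟨n, hn, he⟩ := hedge z z.2 t
    exact Set.mem_iUnion.2 ⟨n, g^[t] z.1, hn, by simp only [he]⟩
  · intro z n
    induction n with
    | zero => exact ⟨0, z.2⟩
    | succ n ih =>
      obtain ⟨t, ht⟩ := ih
      simp only at ht
      obtain ⟨k, hk, hk'⟩ := (hL n).exists_iterate_mem _ (hZL n ht)
      refine ⟨k + t, ?_⟩
      have : ∀ j ≤ k, g^[j] (g^[t] z.1) = (h n)^[j] (g^[t] z.1) := by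
        intro j
        induction j with
        | zero => simp
        | succ j ih =>
          intro hj
          rw [Function.iterate_succ_apply', Function.iterate_succ_apply', ih (by omega),
            hg n _ (hk' j (by omega))]
      simp only [Function.iterate_add_apply]
      rw [this k le_rfl]
      exact hk
  · intro z z' hne
    rw [Set.disjoint_left]
    rintro _ ⟨s, rfl⟩ ⟨t, ht⟩
    exact hne (Subtype.ext (hcancel _ z'.2 _ z.2 t s ht).2.symm)

/-- Two disjoint rays that are connected by edges of `T` are contained, up to initial segments,
in a double ray. -/
theorem exists_doubleRay_of_rays (R₁ R₂ : G.Ray) (hdisj : Disjoint R₁.verts R₂.verts)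
    (T : Set (Sym2 V)) (hT : T ⊆ G.edgeSet)
    (hreach : ∃ x ∈ R₁.verts, ∃ y ∈ R₂.verts, (fromEdgeSet T).Reachable x y) :
    ∃ D : G.DoubleRay, D.edges ⊆ R₁.edges ∪ R₂.edges ∪ T := by
  classical
  -- A shortest connection between the rays is a path that meets them only in its endpoints.
  have hex : ∃ n, ∃ i j, ∃ p : (fromEdgeSet T).Walk (R₁.vertex i) (R₂.vertex j), p.length = n := by
    obtain ⟨_, ⟨i, rfl⟩, _, ⟨j, rfl⟩, ⟨p⟩⟩ := hreach
    exact ⟨_, i, j, p, rfl⟩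
  obtain ⟨i, j, p, hp⟩ := Nat.find_spec hex
  have hmin : ∀ i' j', ∀ q : (fromEdgeSet T).Walk (R₁.vertex i') (R₂.vertex j'),
      Nat.find hex ≤ q.length := fun i' j' q => Nat.find_min' hex ⟨i', j', q, rfl⟩
  generalize Nat.find hex = n at hp hmin
  have hpath : p.IsPath := by
    have h1 := hmin i j p.bypass
    have h2 := p.length_bypass_le_length
    exact p.bypass_eq_self_of_length_le_length_bypass (by omega) ▸ p.bypass_isPath
  have h₁ : ∀ t, 0 < t → t ≤ n → p.getVert t ∉ R₁.verts := by
    rintro t ht htn ⟨i', hi'⟩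
    have := hmin i' j ((p.drop t).copy hi'.symm rfl)
    rw [Walk.length_copy, Walk.drop_length] at this
    omega
  have h₂ : ∀ t, t < n → p.getVert t ∉ R₂.verts := by
    rintro t htn ⟨j', hj'⟩
    have := hmin i j' ((p.take t).copy rfl hj'.symm)
    rw [Walk.length_copy, Walk.take_length] at this
    omega
  -- The integers from 0 to `n` traverse the connecting path; the tail of `R₁` is attached on the
  -- negative side and that of `R₂` beyond `n`.
  let v : ℤ → V := fun k => if k < 0 then R₁.vertex (i + (-k).toNat) else
    if k ≤ n then p.getVert k.toNat else R₂.vertex (j + (k - n).toNat)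
  have v₁ : ∀ t : ℕ, v (-t) = R₁.vertex (i + t) := by
    intro t
    rcases Nat.eq_zero_or_pos t with rfl | ht
    · simp [v]
    · have : (-(t : ℤ)) < 0 := by omega
      simp only [v, this, if_true, neg_neg, Int.toNat_natCast]
  have v₀ : ∀ t : ℕ, t ≤ n → v t = p.getVert t := by
    intro t ht
    have : ¬ ((t : ℤ) < 0) := by omega
    simp [v, this, ht]
  have v₂ : ∀ t : ℕ, v (n + t) = R₂.vertex (j + t) := by
    intro t
    rcases Nat.eq_zero_or_pos t with rfl | ht
    · simpa [← hp] using v₀ n le_rfl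
    · have h1 : ¬ ((n : ℤ) + t < 0) := by omega
      have h2 : ¬ ((n : ℤ) + t ≤ n) := by omega
      simp only [v, h1, h2, if_false]
      congr 2
      omega
  have hcases : ∀ k : ℤ, (∃ t : ℕ, 0 < t ∧ k = -t) ∨ (∃ t : ℕ, t ≤ n ∧ k = t) ∨
      ∃ t : ℕ, 0 < t ∧ k = n + t := by
    intro k
    rcases lt_or_ge k 0 with hk | hk
    · exact Or.inl ⟨(-k).toNat, by omega, by omega⟩
    · rcases le_or_gt k n with hk' | hk'
      · exact Or.inr (Or.inl ⟨k.toNat, by omega, by omega⟩)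
      · exact Or.inr (Or.inr ⟨(k - n).toNat, by omega, by omega⟩)
  have hv : ∀ k, s(v k, v (k + 1)) ∈ R₁.edges ∪ R₂.edges ∪ T := by
    intro k
    rcases hcases k with ⟨t, ht, rfl⟩ | ⟨t, ht, rfl⟩ | ⟨t, ht, rfl⟩
    · obtain ⟨t, rfl⟩ := Nat.exists_eq_add_of_lt ht
      refine Or.inl (Or.inl ⟨i + t, ?_⟩)
      have : (-((0 + t + 1 : ℕ) : ℤ) + 1) = -(t : ℤ) := by push_cast; ring
      rw [this, v₁, v₁, Sym2.eq_swap]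
      simp [add_assoc]
    · rcases ht.lt_or_eq with ht | rfl
      · right
        have : ((t : ℤ) + 1) = ((t + 1 : ℕ) : ℤ) := by push_cast; ring
        rw [this, v₀ t ht.le, v₀ (t + 1) ht]
        exact ((fromEdgeSet_adj _).1 (p.adj_getVert_succ (by omega))).1
      · refine Or.inl (Or.inr ⟨j, ?_⟩)
        have h1 := v₂ 0
        have h2 := v₂ 1
        simp only [Nat.cast_zero, add_zero, Nat.cast_one] at h1 h2
        rw [h1, h2]
    · refine Or.inl (Or.inr ⟨j + t, ?_⟩)
      have : ((n : ℤ) + t + 1) = n + ((t + 1 : ℕ) : ℤ) := by push_cast; ring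
      rw [this, v₂, v₂]
      rfl
  have hinj : Function.Injective v := by
    intro k l hkl
    have hd : ∀ a b, R₁.vertex a ≠ R₂.vertex b := fun a b h =>
      Set.disjoint_left.1 hdisj ⟨a, rfl⟩ (h ▸ ⟨b, rfl⟩)
    have e₁ : ∀ s t : ℕ, 0 < s → t ≤ n → R₁.vertex (i + s) ≠ p.getVert t := by
      intro s t hs ht he
      rcases Nat.eq_zero_or_pos t with rfl | ht0
      · rw [Walk.getVert_zero] at he
        have := R₁.injective he
        omega
      · exact h₁ t ht0 ht ⟨_, he⟩
    have e₂ : ∀ s t : ℕ, 0 < s → t ≤ n → R₂.vertex (j + s) ≠ p.getVert t := by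
      intro s t hs ht he
      rcases ht.lt_or_eq with ht | rfl
      · exact h₂ t ht ⟨_, he⟩
      · rw [← hp, Walk.getVert_length] at he
        have := R₂.injective he
        omega
    rcases hcases k with ⟨s, hs, rfl⟩ | ⟨s, hs, rfl⟩ | ⟨s, hs, rfl⟩ <;>
      rcases hcases l with ⟨t, ht, rfl⟩ | ⟨t, ht, rfl⟩ | ⟨t, ht, rfl⟩
    · rw [v₁, v₁] at hkl
      have := R₁.injective hkl
      omega
    · rw [v₁, v₀ t ht] at hkl
      exact absurd hkl (e₁ s t hs ht)
    · rw [v₁, v₂] at hkl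
      exact absurd hkl (hd _ _)
    · rw [v₁, v₀ s hs] at hkl
      exact absurd hkl.symm (e₁ t s ht hs)
    · rw [v₀ s hs, v₀ t ht] at hkl
      have := hpath.getVert_injOn (by simp [hp, hs]) (by simp [hp, ht]) hkl
      omega
    · rw [v₀ s hs, v₂] at hkl
      exact absurd hkl.symm (e₂ t s ht hs)
    · rw [v₂, v₁] at hkl
      exact absurd hkl.symm (hd _ _)
    · rw [v₂, v₀ t ht] at hkl
      exact absurd hkl (e₂ s t hs ht)
    · rw [v₂, v₂] at hkl
      have := R₂.injective hkl
      omega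
  refine ⟨⟨v, hinj, fun k => ?_⟩, ?_⟩
  · have : s(v k, v (k + 1)) ∈ G.edgeSet := by
      rcases hv k with (h | h) | h
      · exact R₁.edges_subset h
      · exact R₂.edges_subset h
      · exact hT h
    exact this
  · rintro _ ⟨k, rfl⟩
    exact hv k

end SimpleGraph

/-! ### Separating finite sets from an end by vertices and edges. -/

namespace SimpleGraph

variable {V : Type*} {G : SimpleGraph V}

/-- The graph `G` without the edges in `F` and without the edges at the vertices in `Z`. -/
def cut (G : SimpleGraph V) (Z : Set V) (F : Set (Sym2 V)) : SimpleGraph V where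
  Adj x y := G.Adj x y ∧ x ∉ Z ∧ y ∉ Z ∧ s(x, y) ∉ F
  symm := ⟨fun x y h => ⟨h.1.symm, h.2.2.1, h.2.1, by rw [Sym2.eq_swap]; exact h.2.2.2⟩⟩
  loopless := ⟨fun x h => h.1.ne rfl⟩

theorem cut_le {Z : Set V} {F : Set (Sym2 V)} : G.cut Z F ≤ G := fun _ _ h => h.1

theorem eq_of_reachable_cut {Z : Set V} {F : Set (Sym2 V)} {x y : V} (hx : x ∈ Z)
    (h : (G.cut Z F).Reachable x y) : x = y := by
  obtain ⟨p⟩ := h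
  cases p with
  | nil => rfl
  | cons h _ => exact absurd hx h.2.1

namespace Ray

/-- The set of vertices from which a tail of `R` can be reached without meeting `Z` or `F`. -/
def far (R : G.Ray) (Z : Set V) (F : Set (Sym2 V)) : Set V :=
  {v | ∃ n₀, ∀ n, n₀ ≤ n → (G.cut Z F).Reachable v (R.vertex n)}

variable {R : G.Ray} {Z Z' : Set V} {F F' : Set (Sym2 V)}

theorem notMem_of_mem_far {v : V} (hv : v ∈ R.far Z F) : v ∉ Z := by
  intro hvZ
  obtain ⟨n, hn⟩ := hv
  have h1 := eq_of_reachable_cut hvZ (hn n le_rfl)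
  have h2 := eq_of_reachable_cut hvZ (hn (n + 1) (by omega))
  have := R.injective (h1.symm.trans h2)
  omega

theorem mem_far_of_reachable {v w : V} (h : (G.cut Z F).Reachable w v) (hv : v ∈ R.far Z F) :
    w ∈ R.far Z F := by
  obtain ⟨n, hn⟩ := hv
  exact ⟨n, fun k hk => h.trans (hn k hk)⟩

theorem mem_far_of_adj {v w : V} (h : G.Adj w v) (hw : w ∉ Z) (he : s(w, v) ∉ F)
    (hv : v ∈ R.far Z F) : w ∈ R.far Z F :=
  mem_far_of_reachable (Adj.reachable ⟨h, hw, notMem_of_mem_far hv, he⟩) hv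

theorem finite_ends (hF : F.Finite) : {x | ∃ e ∈ F, x ∈ e}.Finite := by
  have : {x | ∃ e ∈ F, x ∈ e} = ⋃ e ∈ F, {x | x ∈ e} := by ext; simp
  rw [this]
  refine hF.biUnion fun e _ => ?_
  induction e with
  | _ x y =>
    refine ((Set.finite_singleton y).insert x).subset fun z hz => ?_
    simpa using hz

theorem exists_tail_adj (R : G.Ray) (hZ : Z.Finite) (hF : F.Finite) :
    ∃ n₀, ∀ n, n₀ ≤ n → (G.cut Z F).Adj (R.vertex n) (R.vertex (n + 1)) := by
  obtain ⟨N, hN⟩ := R.exists_tail (hZ.union (finite_ends hF))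
  refine ⟨N, fun n hn => ⟨R.adj n, fun h => hN n hn (Or.inl h),
    fun h => hN (n + 1) (by omega) (Or.inl h), fun h => hN n hn (Or.inr ⟨_, h, by simp⟩)⟩⟩

theorem exists_tail_mem_far (R : G.Ray) (hZ : Z.Finite) (hF : F.Finite) :
    ∃ n₀, ∀ n, n₀ ≤ n → R.vertex n ∈ R.far Z F := by
  obtain ⟨N, hN⟩ := R.exists_tail_adj hZ hF
  refine ⟨N, fun n hn => ⟨n, fun k hk => ?_⟩⟩
  obtain ⟨k, rfl⟩ := Nat.exists_eq_add_of_le hk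
  induction k with
  | zero => exact Reachable.refl _
  | succ k ih => exact (ih (by omega)).trans (hN (n + k) (by omega)).reachable

theorem reachable_of_mem_far {v w : V} (hv : v ∈ R.far Z F) (hw : w ∈ R.far Z F) :
    (G.cut Z F).Reachable v w := by
  obtain ⟨n, hn⟩ := hv
  obtain ⟨k, hk⟩ := hw
  exact (hn (max n k) (le_max_left _ _)).trans (hk (max n k) (le_max_right _ _)).symm

theorem mem_far_of_walk {v w : V} (p : (G.cut Z F).Walk v w) (hv : v ∈ R.far Z F) :
    ∀ x ∈ p.support, x ∈ R.far Z F := by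
  classical
  exact fun x hx => mem_far_of_reachable (p.takeUntil x hx).reachable.symm hv

/-- Under these hypotheses the new separator removes no edge inside the old far component, so that
component stays connected to the end. -/
theorem far_subset_far (hZ : Disjoint (R.far Z F) Z')
    (hF : ∀ e ∈ F', ∃ x ∈ e, x ∉ R.far Z F) : R.far Z F ⊆ R.far Z' F' := by
  have key : ∀ {v w : V} (p : (G.cut Z F).Walk v w), v ∈ R.far Z F →
      (G.cut Z' F').Reachable v w := by
    intro v w p
    induction p with
    | nil => exact fun _ => Reachable.refl _
    | @cons a b c hab p ih =>
      intro ha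
      have hb : b ∈ R.far Z F := mem_far_of_reachable hab.symm.reachable ha
      have hab' : (G.cut Z' F').Adj a b := by
        refine ⟨hab.1, Set.disjoint_left.1 hZ ha, Set.disjoint_left.1 hZ hb, fun he => ?_⟩
        obtain ⟨x, hx, hxf⟩ := hF _ he
        rcases Sym2.mem_iff.1 hx with rfl | rfl
        · exact hxf ha
        · exact hxf hb
      exact hab'.reachable.trans (ih hb)
  intro v hv
  obtain ⟨n, hn⟩ := hv
  refine ⟨n, fun k hk => ?_⟩
  obtain ⟨p⟩ := hn k hk
  exact key p ⟨n, hn⟩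

theorem far_anti (h : G.cut Z F ≤ G.cut Z' F') : R.far Z F ⊆ R.far Z' F' := by
  rintro v ⟨n, hn⟩
  exact ⟨n, fun k hk => (hn k hk).mono h⟩

/-- A walk that enters `R.far Z F` without using `F` does so from `Z`. -/
theorem exists_mem_of_walk {H : SimpleGraph V} (hH : H ≤ G) (hHF : ∀ e ∈ H.edgeSet, e ∉ F)
    {u w : V} (p : H.Walk u w) (hu : u ∉ R.far Z F) (hw : w ∈ R.far Z F) :
    ∃ x y, H.Adj x y ∧ x ∈ p.support ∧ y ∈ R.far Z F ∧ x ∈ Z := by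
  obtain ⟨d, hd, hd1, hd2⟩ := p.exists_boundary_dart (R.far Z F)ᶜ hu (by simpa using hw)
  simp only [Set.mem_compl_iff, not_not] at hd1 hd2
  refine ⟨d.fst, d.snd, d.adj, p.dart_fst_mem_support_of_mem_darts hd, hd2, ?_⟩
  by_contra hx
  exact hd1 (mem_far_of_adj (hH d.adj) hx (hHF _ d.edge_mem) hd2)

/-- `Z` and `F` separate `U` from the end of `R`. -/
def Separates (R : G.Ray) (U Z : Finset V) (F : Finset (Sym2 V)) : Prop :=
  ∀ u ∈ U, u ∉ R.far Z F

theorem Separates.mono {U U' Z : Finset V} {F : Finset (Sym2 V)} (h : R.Separates U' Z F)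
    (hU : U ⊆ U') : R.Separates U Z F := fun u hu => h u (hU hu)

theorem separates_self (U : Finset V) : R.Separates U U ∅ :=
  fun u hu h => notMem_of_mem_far h (by simpa using hu)

/-- If no vertex of `Z` can be omitted, then all its vertices have neighbours on the far side. -/
theorem exists_adj_far_of_critical [DecidableEq V] {U Z : Finset V} {F : Finset (Sym2 V)}
    (hsep : R.Separates U Z F)
    (hcrit : ∀ z ∈ Z, ¬ R.Separates U (Z.erase z) F) :
    ∀ z ∈ Z, ∃ y ∈ R.far Z F, G.Adj z y := by
  intro z hz
  have := hcrit z hz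
  simp only [Separates, not_forall, not_not] at this
  obtain ⟨u, hu, n, hn⟩ := this
  obtain ⟨N, hN⟩ := R.exists_tail_mem_far (Z := Z) (F := F) Z.finite_toSet F.finite_toSet
  obtain ⟨p⟩ := hn (max n N) (le_max_left _ _)
  obtain ⟨x, y, hxy, _, hy, hx⟩ := exists_mem_of_walk (R := R) (Z := Z) (F := F) cut_le
    (fun e he => by
      induction e with
      | _ a b => exact he.2.2.2)
    p (hsep u hu) (hN _ (le_max_right _ _))
  have hxz : x = z := by
    by_contra hne
    exact hxy.2.1 (by simpa [hne] using hx)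
  subst hxz
  exact ⟨y, hy, hxy.1⟩

/-- `Z` and `F` separate `U` from the end of `R`, and they do so economically: all vertices of `Z`
have neighbours on the far side, `F` has at most `κ` edges, and no separator is much smaller. -/
structure IsTight (R : G.Ray) (m κ : ℕ) (U Z : Finset V) (F : Finset (Sym2 V)) : Prop where
  separates : R.Separates U Z F
  card_le : F.card ≤ κ
  exists_adj : ∀ z ∈ Z, ∃ y ∈ R.far Z F, G.Adj z y
  robust : ∀ (Y : Finset V) (E : Finset (Sym2 V)), R.Separates U Y E →
    m * Z.card ≤ m * Y.card + (E.card - 2 * κ)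

/-- `U'` contains `Z`, the ends of `F` and separators of the vertices of `Z`. -/
structure Covers (R : G.Ray) (Z : Finset V) (F : Finset (Sym2 V)) (U' : Finset V) : Prop where
  subset : Z ⊆ U'
  ends : ∀ e ∈ F, ∀ x ∈ e, x ∈ U'
  undominated : ∀ z ∈ Z, ∃ S ⊆ U', z ∉ S ∧ z ∉ R.far S ∅

section Step

variable {m κ m' : ℕ} {U Z U' Z' : Finset V} {F F' : Finset (Sym2 V)}

theorem Covers.far_subset (hc : R.Covers Z F U') (hs : R.Separates U' Z' F') :
    R.far Z' F' ⊆ R.far Z F := by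
  refine far_subset_far ?_ ?_
  · rw [Set.disjoint_left]
    exact fun x hx hxZ => hs x (hc.subset hxZ) hx
  · intro e he
    induction e with
    | _ a b => exact ⟨a, by simp, hs a (hc.ends _ he a (by simp))⟩

/-- Absence of domination makes consecutive separators disjoint: a vertex of `Z` is cut off from the
end by some `S ⊆ U'` avoiding it, so it has no neighbour beyond `Z'`, while every vertex of `Z'` has
one. -/
theorem Covers.subset_far (hc : R.Covers Z F U') (hs : R.Separates U' Z' F')
    (hadj : ∀ z ∈ Z', ∃ y ∈ R.far Z' F', G.Adj z y) : (Z' : Set V) ⊆ R.far Z F := by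
  intro z hz
  obtain ⟨y, hy, hzy⟩ := hadj z hz
  refine mem_far_of_adj hzy ?_ ?_ (hc.far_subset hs hy)
  · intro hzZ
    obtain ⟨S, hSU, hzS, hzf⟩ := hc.undominated z hzZ
    refine hzf (mem_far_of_adj hzy (by simpa using hzS) (by simp) ?_)
    refine far_subset_far ?_ (by simp) hy
    rw [Set.disjoint_left]
    exact fun x hx hxS => hs x (hSU hxS) hx
  · intro he
    exact hs y (hc.ends _ he y (by simp)) hy

/-- Consecutive tight separators are joined by many edge-disjoint linkages. -/
theorem exists_linkages (ht : R.IsTight m κ U Z F) (hc : R.Covers Z F U')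
    (ht' : R.IsTight m' κ U' Z' F') (hm : m = 1 ∨ Z.card = Z'.card) :
    ∃ (L : Fin m → Set V) (h : Fin m → V → V),
      (∀ i, G.IsLinkage Z Z' (L i) (h i)) ∧
      (∀ i, ∀ x ∈ L i, x ∈ Z ∨ x ∈ R.far Z F) ∧ (∀ i, Disjoint (L i) (R.far Z' F')) ∧
      ∀ i j, i ≠ j → Disjoint (linkageEdges (L i) (h i)) (linkageEdges (L j) (h j)) := by
  classical
  -- Without `F` and `F'`, a path can cross to either far side only through `Z` or `Z'`,
  -- respectively.
  let H : SimpleGraph V := G.cut ∅ (F ∪ F')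
  have hZ' : (Z' : Set V) ⊆ R.far Z F := hc.subset_far ht'.separates ht'.exists_adj
  obtain ⟨L, h, hL, hdisj⟩ := H.exists_edgeDisjoint_linkages Z Z' (by
    rw [Finset.disjoint_left]
    exact fun z hz hz' => notMem_of_mem_far (hZ' hz') hz) m hm (by
    intro Y E hYE
    -- A path from `U` to the end that avoids `F` and `F'` meets `Z` and then `Z'`, so it contains a
    -- walk from `Z` to `Z'`. The allowance `2 * κ` in `robust` pays for adding `F` and `F'` to the
    -- separator.
    have hsep : R.Separates U Y (E ∪ F ∪ F') := by
      intro u hu huf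
      obtain ⟨n, hn⟩ := huf
      obtain ⟨N, hN⟩ := R.exists_tail_mem_far (Z := Z) (F := F) Z.finite_toSet F.finite_toSet
      obtain ⟨N', hN'⟩ := R.exists_tail_mem_far (Z := Z') (F := F') Z'.finite_toSet F'.finite_toSet
      let k := max n (max N N')
      have hk : n ≤ k := le_max_left _ _
      have hkN : N ≤ k := (le_max_left _ _).trans (le_max_right _ _)
      have hkN' : N' ≤ k := (le_max_right _ _).trans (le_max_right _ _)
      have hnotF : ∀ e ∈ (G.cut Y ((E ∪ F ∪ F' : Finset (Sym2 V)) : Set (Sym2 V))).edgeSet,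
          e ∉ E ∪ F ∪ F' := by
        intro e he
        induction e with
        | _ a b => exact he.2.2.2
      obtain ⟨p⟩ := hn k hk
      obtain ⟨x, y, hxy, hxp, hy, hxZ⟩ := exists_mem_of_walk (R := R) (Z := Z) (F := F) cut_le
        (fun e he h => hnotF e he (by simp [Finset.mem_coe.1 h])) p (ht.separates u hu) (hN k hkN)
      have hxk := (p.dropUntil x hxp).reachable
      obtain ⟨q⟩ := hxk
      obtain ⟨x', y', hxy', hxq', hy', hxZ'⟩ := exists_mem_of_walk (R := R) (Z := Z') (F := F')
        cut_le (fun e he h => hnotF e he (by simp [Finset.mem_coe.1 h])) q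
        (ht'.separates x (hc.subset hxZ)) (hN' k hkN')
      let w := q.takeUntil x' hxq'
      have hwle : ∀ {a b : V} (w : (G.cut Y ((E ∪ F ∪ F' : Finset (Sym2 V)) : Set (Sym2 V))).Walk
          a b), a ∉ Y → ∃ w' : H.Walk a b, (∀ x ∈ w'.support, x ∉ Y) ∧ ∀ e ∈ w'.edges, e ∉ E := by
        intro a b w
        induction w with
        | nil => exact fun ha => ⟨Walk.nil, by simpa using ha, by simp⟩
        | @cons a b c hab w ih =>
          intro ha
          obtain ⟨w', h1, h2⟩ := ih (by simpa using hab.2.2.1)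
          have hno := hab.2.2.2
          simp only [Finset.coe_union, Set.mem_union, not_or, Finset.mem_coe] at hno
          have hab' : H.Adj a b := ⟨hab.1, by simp, by simp, by simp [hno]⟩
          refine ⟨Walk.cons hab' w', ?_, ?_⟩
          · intro z hz
            rw [Walk.support_cons, List.mem_cons] at hz
            rcases hz with rfl | hz
            · exact ha
            · exact h1 z hz
          · intro e he
            rw [Walk.edges_cons, List.mem_cons] at he
            rcases he with rfl | he
            · exact hno.1.1
            · exact h2 e he
      obtain ⟨w', hw1, hw2⟩ := hwle w (by simpa using hxy.2.1)
      rcases hYE x hxZ x' hxZ' w' with ⟨z, hz, hzY⟩ | ⟨e, he, heE⟩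
      · exact hw1 z hz hzY
      · exact hw2 e he heE
    have h1 := ht.robust Y _ hsep
    have h2 := Finset.card_union_le (E ∪ F) F'
    have h3 := Finset.card_union_le E F
    have h4 := ht.card_le
    have h5 := ht'.card_le
    omega)
  have hHe : ∀ {a b}, H.Adj a b → s(a, b) ∉ F ∧ s(a, b) ∉ F' := by
    intro a b hab
    have := hab.2.2.2
    simpa [not_or] using this
  refine ⟨L, h, fun i => (hL i).mono cut_le, fun i => ?_, fun i => ?_, hdisj⟩
  · refine (hL i).backward_induction _ (fun z hz => Or.inr (hZ' hz)) fun x hx hhx => ?_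
    by_cases hxZ : x ∈ Z
    · exact Or.inl hxZ
    · have hadj := (hL i).adj x hx
      refine Or.inr (mem_far_of_adj hadj.1 (by simpa using hxZ) (by simpa using (hHe hadj).1) ?_)
      exact hhx.resolve_left fun h => (hL i).notMem_source x hx h
  · rw [Set.disjoint_left]
    refine (hL i).forward_induction _ (fun z hz => ht'.separates z (hc.subset hz)) ?_
    intro x hx hxf _ hhx
    have hadj := (hL i).adj x hx
    exact hxf (mem_far_of_adj hadj.1 (Set.disjoint_left.1 (hL i).disjoint hx)
      (by simpa using (hHe hadj).2) hhx)

end Step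

end Ray

end SimpleGraph

/-! ### Chains of tight separators. -/

namespace SimpleGraph

variable {V : Type*} {G : SimpleGraph V}

namespace Ray

variable {R : G.Ray}

theorem equivalent_of_forall_exists_mem_far {R' : G.Ray}
    (h : ∀ S : Set V, S.Finite → ∃ t, R'.vertex t ∈ R.far S ∅) : R'.Equivalent R := by
  rw [equivalent_iff]
  intro S hS
  obtain ⟨t, ht⟩ := h S hS
  obtain ⟨n, hn⟩ := id ht
  obtain ⟨p⟩ := hn n le_rfl
  refine ⟨t, n, p.mapLe cut_le, fun x hx => ?_⟩
  rw [Walk.support_mapLe_eq_support] at hx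
  exact notMem_of_mem_far (mem_far_of_walk p ht x hx)

theorem mem_far_of_avoiding_walk {Z : Set V} {F : Set (Sym2 V)} {v w : V} (p : G.Walk v w)
    (hp : ∀ x ∈ p.support, x ∉ Z ∧ ∀ e ∈ F, x ∉ e) (hw : w ∈ R.far Z F) : v ∈ R.far Z F := by
  induction p with
  | nil => exact hw
  | @cons a b c hab p ih =>
    have ha := hp a (by simp)
    exact mem_far_of_adj hab ha.1 (fun he => ha.2 _ he (by simp))
      (ih (fun x hx => hp x (by simp [hx])) hw)

/-- The starting vertex of a ray that is equivalent to `R` and avoids `Z` and `F` is not separated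
from `R` by `Z` and `F`. -/
theorem Equivalent.mem_far {T : G.Ray} (hT : T.Equivalent R) {Z : Set V} {F : Set (Sym2 V)}
    (hZ : Z.Finite) (hF : F.Finite) (hTZ : Disjoint T.verts Z) (hTF : Disjoint T.edges F) :
    T.vertex 0 ∈ R.far Z F := by
  obtain ⟨N, hN⟩ := R.exists_tail_mem_far hZ hF
  rw [equivalent_iff] at hT
  obtain ⟨m, n, p, hp⟩ := hT (Z ∪ {x | ∃ e ∈ F, x ∈ e} ∪ R.vertex '' Set.Iio N)
    ((hZ.union (finite_ends hF)).union ((Set.finite_Iio N).image _))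
  have hn : N ≤ n := by
    by_contra hlt
    exact hp _ p.end_mem_support (Or.inr ⟨n, not_le.mp hlt, rfl⟩)
  have hm : T.vertex m ∈ R.far Z F := by
    refine mem_far_of_avoiding_walk p (fun x hx => ⟨fun h => hp x hx (Or.inl (Or.inl h)), ?_⟩)
      (hN n hn)
    exact fun e he hxe => hp x hx (Or.inl (Or.inr ⟨e, he, hxe⟩))
  clear hp p
  induction m with
  | zero => exact hm
  | succ m ih =>
    exact ih (mem_far_of_adj (T.adj m) (Set.disjoint_left.1 hTZ ⟨m, rfl⟩)
      (Set.disjoint_left.1 hTF ⟨m, rfl⟩) hm)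

/-- A sequence of tight separators that converges to the end of `R`. -/
structure IsChain (R : G.Ray) (m : ℕ → ℕ) (κ : ℕ) (U Z : ℕ → Finset V)
    (F : ℕ → Finset (Sym2 V)) : Prop where
  tight : ∀ n, R.IsTight (m n) κ (U n) (Z n) (F n)
  covers : ∀ n, R.Covers (Z n) (F n) (U (n + 1))
  exhausts : ∀ v, ∃ n, v ∉ R.far (Z n) (F n)

/-- Countability lets the separators leave every vertex behind. The predicate `Q` records the sizes
of the separators, and `ext` lets the next finite set swallow the walks needed for turns. -/
theorem exists_isChain [Countable V] (R : G.Ray) (m : ℕ → ℕ) (κ : ℕ)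
    (hdom : ∀ v, ∃ S : Finset V, v ∉ S ∧ v ∉ R.far S ∅)
    (Q : Finset V → Finset (Sym2 V) → Prop) (ext : Finset V → Finset (Sym2 V) → Finset V)
    (hnext : ∀ (n : ℕ) (X : Finset V), ∃ U Z F, X ⊆ U ∧ R.IsTight (m n) κ U Z F ∧ Q Z F) :
    ∃ U Z F, R.IsChain m κ U Z F ∧ (∀ n, Q (Z n) (F n)) ∧
      ∀ n, ext (Z n) (F n) ⊆ U (n + 1) := by
  classical
  choose S hS hS' using hdom
  have : Nonempty V := ⟨R.vertex 0⟩
  obtain ⟨enum, henum⟩ := exists_surjective_nat V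
  choose u z f hu ht hQ using hnext
  -- The first three terms secure `Covers`, the vertex `enum n` secures `exhausts`.
  let grow : ℕ → Finset V × Finset V × Finset (Sym2 V) → Finset V := fun n s =>
    s.2.1 ∪ s.2.2.biUnion Sym2.toFinset ∪ s.2.1.biUnion S ∪ {enum n} ∪ ext s.2.1 s.2.2
  let next : ℕ → Finset V → Finset V × Finset V × Finset (Sym2 V) := fun n X =>
    (u n X, z n X, f n X)
  let s : ℕ → Finset V × Finset V × Finset (Sym2 V) := fun n =>
    Nat.rec (next 0 ∅) (fun n s => next (n + 1) (grow n s)) n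
  have hs : ∀ n, ∃ X, s n = next n X := by
    intro n
    cases n with
    | zero => exact ⟨∅, rfl⟩
    | succ n => exact ⟨grow n (s n), rfl⟩
  have hsucc : ∀ n, grow n (s n) ⊆ (s (n + 1)).1 := fun n => hu (n + 1) (grow n (s n))
  have htight : ∀ n, R.IsTight (m n) κ (s n).1 (s n).2.1 (s n).2.2 := by
    intro n
    obtain ⟨X, hX⟩ := hs n
    rw [hX]
    exact ht n X
  refine ⟨fun n => (s n).1, fun n => (s n).2.1, fun n => (s n).2.2, ⟨htight, ?_, ?_⟩, ?_, ?_⟩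
  · intro n
    refine ⟨fun x hx => hsucc n ?_, fun e he x hx => hsucc n ?_, fun y hy =>
      ⟨S y, fun x hx => hsucc n ?_, hS y, hS' y⟩⟩
    · simp only [grow, Finset.mem_union]
      exact Or.inl (Or.inl (Or.inl (Or.inl hx)))
    · simp only [grow, Finset.mem_union, Finset.mem_biUnion]
      exact Or.inl (Or.inl (Or.inl (Or.inr ⟨e, he, by simpa using hx⟩)))
    · simp only [grow, Finset.mem_union, Finset.mem_biUnion]
      exact Or.inl (Or.inl (Or.inr ⟨y, hy, hx⟩))
  · intro v
    obtain ⟨n, rfl⟩ := henum v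
    refine ⟨n + 1, (htight (n + 1)).separates _ (hsucc n ?_)⟩
    simp [grow]
  · intro n
    obtain ⟨X, hX⟩ := hs n
    simp only [hX]
    exact hQ n X
  · intro n x hx
    refine hsucc n ?_
    simp only [grow, Finset.mem_union]
    exact Or.inr hx

namespace IsChain

variable {m : ℕ → ℕ} {κ : ℕ} {U Z : ℕ → Finset V} {F : ℕ → Finset (Sym2 V)}

theorem far_antitone (hc : R.IsChain m κ U Z F) : Antitone fun n => R.far (Z n) (F n) :=
  antitone_nat_of_succ_le fun n => (hc.covers n).far_subset (hc.tight (n + 1)).separates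

theorem subset_far (hc : R.IsChain m κ U Z F) (n : ℕ) :
    (Z (n + 1) : Set V) ⊆ R.far (Z n) (F n) :=
  (hc.covers n).subset_far (hc.tight (n + 1)).separates (hc.tight (n + 1)).exists_adj

theorem exists_far_subset (hc : R.IsChain m κ U Z F) {S : Set V} (hS : S.Finite) :
    ∃ n, R.far (Z n) (F n) ⊆ R.far S ∅ := by
  have : ∃ n, ∀ x ∈ S, x ∉ R.far (Z n) (F n) := by
    choose n hn using hc.exhausts
    obtain ⟨N, hN⟩ := (hS.image n).bddAbove
    exact ⟨N, fun x hx h => hn x (hc.far_antitone (hN ⟨x, hx, rfl⟩) h)⟩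
  obtain ⟨n, hn⟩ := this
  exact ⟨n, far_subset_far (Set.disjoint_left.2 fun x hx hxS => hn x hxS hx) (by simp)⟩

/-- A level lies between two consecutive separators, and the far sides are nested. -/
theorem disjoint_levels (hc : R.IsChain m κ U Z F) {L : ℕ → Set V} (N : ℕ)
    (hL : ∀ n, N ≤ n → ∀ x ∈ L n, x ∈ Z n ∨ x ∈ R.far (Z n) (F n))
    (hL' : ∀ n, N ≤ n → Disjoint (L n) (R.far (Z (n + 1)) (F (n + 1))))
    (hL'' : ∀ n, N ≤ n → Disjoint (L n) (Z (n + 1))) :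
    ∀ n k, N ≤ n → N ≤ k → n ≠ k → Disjoint (L n) (L k) := by
  have key : ∀ n k, N ≤ n → n < k → Disjoint (L n) (L k) := by
    intro n k hn hnk
    rw [Set.disjoint_left]
    intro x hx hxk
    obtain ⟨k, rfl⟩ := Nat.exists_eq_add_of_lt hnk
    rcases hL _ (by omega) x hxk with h | h
    · cases k with
      | zero => exact Set.disjoint_left.1 (hL'' n hn) hx h
      | succ k =>
        exact Set.disjoint_left.1 (hL' n hn) hx
          (hc.far_antitone (show n + 1 ≤ n + (k + 1) by omega) (hc.subset_far _ h))
    · exact Set.disjoint_left.1 (hL' n hn) hx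
        (hc.far_antitone (show n + 1 ≤ n + k + 1 by omega) h)
  intro n k hn hk hne
  rcases Nat.lt_or_gt_of_ne hne with h | h
  · exact key n k hn h
  · exact (key k n hk h).symm

end IsChain

/-- If the end of `R` is undominated and contains at most `N` disjoint rays, then all finite sets
are separated from it by at most `N` vertices. -/
theorem exists_separator_card_le [Countable V] (R : G.Ray)
    (hdom : ∀ v, ∃ S : Finset V, v ∉ S ∧ v ∉ R.far S ∅) (N : ℕ)
    (hthin : ∀ ρ : Fin (N + 1) → G.Ray, (∀ i, (ρ i).Equivalent R) →
      ¬ Pairwise fun i j => Disjoint (ρ i).verts (ρ j).verts) (U : Finset V) :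
    ∃ Z : Finset V, Z.card ≤ N ∧ R.Separates U Z ∅ := by
  classical
  by_contra! hU
  have hnext : ∀ (n : ℕ) (X : Finset V), ∃ (U' Z : Finset V) (F : Finset (Sym2 V)),
      X ⊆ U' ∧ R.IsTight 1 0 U' Z F ∧ N < Z.card := by
    intro _ X
    have hex : ∃ n, ∃ Z : Finset V, R.Separates (X ∪ U) Z ∅ ∧ Z.card = n :=
      ⟨_, _, separates_self _, rfl⟩
    obtain ⟨Z, hZ, hcard⟩ := Nat.find_spec hex
    have hmin : ∀ Y : Finset V, R.Separates (X ∪ U) Y ∅ → Z.card ≤ Y.card := fun Y hY => by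
      rw [hcard]
      exact Nat.find_min' hex ⟨Y, hY, rfl⟩
    refine ⟨X ∪ U, Z, ∅, Finset.subset_union_left, ⟨hZ, by simp, ?_, ?_⟩, ?_⟩
    · refine exists_adj_far_of_critical hZ fun z hz h => ?_
      have h1 := hmin _ h
      rw [Finset.card_erase_of_mem hz] at h1
      have := Finset.card_pos.2 ⟨z, hz⟩
      omega
    · intro Y E hYE
      -- Replacing each edge of `E` by one of its ends turns a mixed separator into a vertex
      -- separator of no larger total size; this is `robust` with `m = 1` and `κ = 0`.
      have h1 := hmin (Y ∪ E.image fun e => e.out.1) fun u hu huf => hYE u hu (by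
        refine far_anti ?_ huf
        intro x y hxy
        obtain ⟨h1, h2, h3, -⟩ := hxy
        simp only [Finset.coe_union, Finset.coe_image, Set.mem_union, not_or] at h2 h3
        refine ⟨h1, h2.1, h3.1, fun he => ?_⟩
        have hmem : (s(x, y)).out.1 ∈ s(x, y) := Sym2.out_fst_mem _
        rcases Sym2.mem_iff.1 hmem with h | h
        · exact h2.2 ⟨_, he, h⟩
        · exact h3.2 ⟨_, he, h⟩)
      have h2 := Finset.card_union_le Y (E.image fun e => e.out.1)
      have h3 := Finset.card_image_le (s := E) (f := fun e => e.out.1)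
      omega
    · by_contra hle
      exact hU Z (by omega) (hZ.mono Finset.subset_union_right)
  -- If all separators had more than `N` vertices, single linkages along a chain would concatenate
  -- to more than `N` disjoint rays of the end.
  obtain ⟨U', Z, F, hc, hQ, -⟩ := R.exists_isChain (fun _ => 1) 0 hdom (fun Z _ => N < Z.card)
    (fun _ _ => ∅) hnext
  have hlink := fun n => exists_linkages (hc.tight n) (hc.covers n) (hc.tight (n + 1)) (Or.inl rfl)
  choose L h hL hL1 hL2 _ using hlink
  obtain ⟨ρ, _, _, hρ, hdisj⟩ := exists_rays_of_linkages (fun n => (Z n : Set V))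
    (fun n => L n 0) (fun n => h n 0) (fun n => hL n 0)
    (fun n k => hc.disjoint_levels 0 (L := fun n => L n 0) (fun n _ => hL1 n 0) (fun n _ => hL2 n 0)
      (fun n _ => (hL n 0).disjoint) n k (Nat.zero_le _) (Nat.zero_le _))
  obtain ⟨e⟩ : Nonempty (Fin (N + 1) ↪ (Z 0 : Set V)) := by
    apply Function.Embedding.nonempty_of_card_le
    simpa using hQ 0
  refine hthin (fun i => ρ (e i)) (fun i => ?_) fun i j hij => hdisj _ _ (e.injective.ne hij)
  refine equivalent_of_forall_exists_mem_far fun S hS => ?_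
  obtain ⟨n, hn⟩ := hc.exists_far_subset hS
  obtain ⟨t, ht⟩ := hρ (e i) (n + 1)
  exact ⟨t, hn (hc.subset_far n ht)⟩

end Ray

end SimpleGraph

/-! ### Turns, and the theorem for undominated ends. -/

namespace SimpleGraph

variable {V : Type*} {G : SimpleGraph V}

/-- A walk between two starting points of several edge-disjoint linkages can be rerouted along two
of the linkages so that it joins two of their endpoints and avoids all other linkages. -/
theorem exists_turn {Z Z' : Set V} {m : ℕ} {L : Fin m → Set V} {h : Fin m → V → V}
    (hL : ∀ i, G.IsLinkage Z Z' (L i) (h i))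
    (hdisj : ∀ i j, i ≠ j → Disjoint (linkageEdges (L i) (h i)) (linkageEdges (L j) (h j)))
    (i₀ : Fin m) {z₀ z₁ : V} (h₀ : z₀ ∈ Z) (h₁ : z₁ ∈ Z) (hne : z₀ ≠ z₁) (q : G.Walk z₀ z₁) :
    ∃ i j, ∃ a ∈ Z', ∃ b ∈ Z', a ≠ b ∧ ∃ T : Set (Sym2 V), (fromEdgeSet T).Reachable a b ∧
      (∀ e ∈ T, e ∈ q.edges ∨ e ∈ linkageEdges (L i) (h i) ∨ e ∈ linkageEdges (L j) (h j)) ∧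
      ∀ k, k ≠ i → k ≠ j → Disjoint T (linkageEdges (L k) (h k)) := by
  obtain ⟨a, ha, b, hb, hab, hza, hzb⟩ := (hL i₀).exists_reachable_ne h₀ h₁ hne
  let E : Set (Sym2 V) := {e | e ∈ q.edges ∧ ∀ i, e ∉ linkageEdges (L i) (h i)}
  -- A vertex may satisfy both `M` and `N`, through different linkages. The walk `q` starts in `M`
  -- and ends in `N`; what is wanted is a segment from `M` to `N` without linkage edges.
  let M : V → Prop := fun v => ∃ i, (fromEdgeSet (linkageEdges (L i) (h i))).Reachable v a
  let N : V → Prop := fun v => ∃ i, ∃ b ∈ Z', b ≠ a ∧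
    (fromEdgeSet (linkageEdges (L i) (h i))).Reachable v b
  -- Walking back from the end of `q`, consider a linkage edge. Both its ends are linked to the same
  -- point of `Z'`: if that point is `a`, the sought segment has been found; otherwise the segment
  -- can be restarted at the earlier vertex, which lies in `N`.
  have key : ∀ {v w : V} (p : G.Walk v w), (∀ e ∈ p.edges, e ∈ q.edges) → N w →
      (∃ v' w', M v' ∧ N w' ∧ (fromEdgeSet E).Reachable v' w') ∨
      ∃ w', N w' ∧ (fromEdgeSet E).Reachable v w' := by
    intro v w p
    induction p with
    | nil => exact fun _ hN => Or.inr ⟨_, hN, Reachable.refl _⟩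
    | @cons v x w hvx p ih =>
      intro hp hN
      rcases ih (fun e he => hp e (by simp [he])) hN with h1 | ⟨w', hw', hr⟩
      · exact Or.inl h1
      by_cases hsys : ∃ i, s(v, x) ∈ linkageEdges (L i) (h i)
      · obtain ⟨i, hi⟩ := hsys
        have hvx' : (fromEdgeSet (linkageEdges (L i) (h i))).Adj v x :=
          (fromEdgeSet_adj _).2 ⟨hi, hvx.ne⟩
        obtain ⟨c, hc, hxc⟩ : ∃ c ∈ Z',
            (fromEdgeSet (linkageEdges (L i) (h i))).Reachable x c := by
          obtain ⟨y, hy, hyv⟩ := hi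
          obtain ⟨c, hc, hyc⟩ := (hL i).exists_reachable hy
          refine ⟨c, hc, ?_⟩
          rcases Sym2.eq_iff.1 hyv with ⟨rfl, _⟩ | ⟨rfl, _⟩
          · exact hvx'.symm.reachable.trans hyc
          · exact hyc
        by_cases hca : c = a
        · exact Or.inl ⟨x, w', ⟨i, hca ▸ hxc⟩, hw', hr⟩
        · exact Or.inr ⟨v, ⟨i, c, hc, hca, hvx'.reachable.trans hxc⟩, Reachable.refl _⟩
      · refine Or.inr ⟨w', hw', Reachable.trans (Adj.reachable ?_) hr⟩
        exact (fromEdgeSet_adj _).2 ⟨⟨hp _ (by simp), fun i hi => hsys ⟨i, hi⟩⟩, hvx.ne⟩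
  obtain ⟨v, w, ⟨i, hv⟩, ⟨j, c, hc, hca, hw⟩, hr⟩ :
      ∃ v' w', M v' ∧ N w' ∧ (fromEdgeSet E).Reachable v' w' := by
    rcases key q (fun e he => he) ⟨i₀, b, hb, hab.symm, hzb⟩ with h1 | ⟨w', hw', hr⟩
    · exact h1
    · exact ⟨z₀, w', ⟨i₀, hza⟩, hw', hr⟩
  refine ⟨i, j, a, ha, c, hc, hca.symm, E ∪ linkageEdges (L i) (h i) ∪ linkageEdges (L j) (h j),
    ?_, ?_, ?_⟩
  · refine (hv.symm.mono (fromEdgeSet_mono ?_)).trans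
      ((hr.mono (fromEdgeSet_mono ?_)).trans (hw.mono (fromEdgeSet_mono ?_)))
    · exact fun e he => Or.inl (Or.inr he)
    · exact fun e he => Or.inl (Or.inl he)
    · exact fun e he => Or.inr he
  · rintro e ((he | he) | he)
    · exact Or.inl he.1
    · exact Or.inr (Or.inl he)
    · exact Or.inr (Or.inr he)
  · intro k hki hkj
    rw [Set.disjoint_left]
    rintro e ((he | he) | he) hek
    · exact he.2 k hek
    · exact Set.disjoint_left.1 (hdisj k i hki) hek he
    · exact Set.disjoint_left.1 (hdisj k j hkj) hek he

/-- The pairs of vertices outside `C'` that meet `C`. -/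
def band (C C' : Set V) : Set (Sym2 V) :=
  {e | (∃ x ∈ e, x ∈ C) ∧ ∀ x ∈ e, x ∉ C'}

namespace Ray

variable {R : G.Ray}

/-- Vertices of a tight separator have neighbours on the far side, which is connected. The resulting
walk is what `exists_turn` reroutes. -/
theorem IsTight.exists_walk {m κ : ℕ} {U Z : Finset V} {F : Finset (Sym2 V)}
    (ht : R.IsTight m κ U Z F) (hZ : 2 ≤ Z.card) :
    ∃ z₀ ∈ Z, ∃ z₁ ∈ Z, z₀ ≠ z₁ ∧ ∃ q : G.Walk z₀ z₁,
      ∀ e ∈ q.edges, ∃ x ∈ e, x ∈ R.far Z F := by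
  obtain ⟨z₀, h₀, z₁, h₁, hne⟩ := Finset.one_lt_card.1 hZ
  obtain ⟨y₀, hy₀, hadj₀⟩ := ht.exists_adj z₀ h₀
  obtain ⟨y₁, hy₁, hadj₁⟩ := ht.exists_adj z₁ h₁
  obtain ⟨p⟩ := reachable_of_mem_far hy₀ hy₁
  refine ⟨z₀, h₀, z₁, h₁, hne,
    Walk.cons hadj₀ ((p.mapLe cut_le).append (Walk.cons hadj₁.symm Walk.nil)), ?_⟩
  intro e he
  simp only [Walk.edges_cons, Walk.edges_append, Walk.edges_nil, Walk.edges_mapLe_eq_edges,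
    List.mem_cons, List.mem_append, List.not_mem_nil, or_false] at he
  rcases he with rfl | he | rfl
  · exact ⟨y₀, by simp, hy₀⟩
  · induction e with
    | _ a b =>
      exact ⟨a, by simp, mem_far_of_walk p hy₀ a (p.fst_mem_support_of_mem_edges he)⟩
  · exact ⟨y₁, by simp, hy₁⟩

/-- Between consecutive tight separators there are `n` edge-disjoint linkages together with a
connection of two endpoints that uses no edges of these linkages. -/
theorem exists_linkages_and_turn {n κ m' : ℕ} {U Z U' Z' : Finset V} {F F' : Finset (Sym2 V)}
    (ht : R.IsTight (n + 2) κ U Z F) (hc : R.Covers Z F U') (ht' : R.IsTight m' κ U' Z' F')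
    (hcard : Z.card = Z'.card)
    (hq : ∃ z₀ ∈ Z, ∃ z₁ ∈ Z, z₀ ≠ z₁ ∧ ∃ q : G.Walk z₀ z₁,
      (∀ e ∈ q.edges, ∃ x ∈ e, x ∈ R.far Z F) ∧ ∀ x ∈ q.support, x ∈ U') :
    ∃ (L : ℕ → Set V) (h : ℕ → V → V),
      (∀ i < n, G.IsLinkage Z Z' (L i) (h i)) ∧
      (∀ i < n, ∀ x ∈ L i, x ∈ Z ∨ x ∈ R.far Z F) ∧ (∀ i < n, Disjoint (L i) (R.far Z' F')) ∧
      (∀ i < n, linkageEdges (L i) (h i) ⊆ band (R.far Z F) (R.far Z' F')) ∧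
      (∀ i < n, ∀ j < n, i ≠ j →
        Disjoint (linkageEdges (L i) (h i)) (linkageEdges (L j) (h j))) ∧
      ∃ a ∈ Z', ∃ b ∈ Z', a ≠ b ∧ ∃ T : Set (Sym2 V), (fromEdgeSet T).Reachable a b ∧
        T ⊆ G.edgeSet ∧ T ⊆ band (R.far Z F) (R.far Z' F') ∧
        ∀ i < n, Disjoint T (linkageEdges (L i) (h i)) := by
  classical
  obtain ⟨L, h, hL, hL1, hL2, hdisj⟩ := exists_linkages ht hc ht' (Or.inr hcard)
  have hZ' := hc.subset_far ht'.separates ht'.exists_adj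
  have hband : ∀ i, linkageEdges (L i) (h i) ⊆ band (R.far Z F) (R.far Z' F') := by
    rintro i _ ⟨x, hx, rfl⟩
    refine ⟨⟨h i x, by simp, ?_⟩, fun y hy => ?_⟩
    · rcases (hL i).mapsTo x hx with h1 | h1
      · exact (hL1 i _ h1).resolve_left ((hL i).notMem_source x hx)
      · exact hZ' h1
    · rcases Sym2.mem_iff.1 hy with rfl | rfl
      · exact Set.disjoint_left.1 (hL2 i) hx
      · rcases (hL i).mapsTo x hx with h1 | h1
        · exact Set.disjoint_left.1 (hL2 i) h1
        · exact fun h2 => notMem_of_mem_far h2 h1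
  obtain ⟨z₀, h₀, z₁, h₁, hne, q, hq1, hq2⟩ := hq
  obtain ⟨i, j, a, ha, b, hb, hab, T, hTr, hTsub, hTdisj⟩ :=
    exists_turn hL hdisj 0 h₀ h₁ hne q
  -- The turn spoils at most the linkages `i` and `j`; the remaining ones are renumbered.
  obtain ⟨σ⟩ : Nonempty (Fin n ↪ {k : Fin (n + 2) // k ∉ ({i, j} : Finset (Fin (n + 2)))}) := by
    apply Function.Embedding.nonempty_of_card_le
    rw [Fintype.card_fin, Fintype.card_subtype_compl]
    have : Fintype.card {k : Fin (n + 2) // k ∈ ({i, j} : Finset (Fin (n + 2)))} ≤ 2 := by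
      rw [Fintype.card_coe]
      exact Finset.card_le_two
    rw [Fintype.card_fin]
    omega
  let τ : ℕ → Fin (n + 2) := fun k => if hk : k < n then σ ⟨k, hk⟩ else i
  have hτ : ∀ k < n, τ k ≠ i ∧ τ k ≠ j := by
    intro k hk
    have := (σ ⟨k, hk⟩).2
    simp only [Finset.mem_insert, Finset.mem_singleton, not_or] at this
    simpa only [τ, hk, dite_true] using this
  have hτinj : ∀ k < n, ∀ l < n, k ≠ l → τ k ≠ τ l := by
    intro k hk l hl hkl he
    simp only [τ, hk, hl, dite_true] at he
    have := σ.injective (Subtype.ext he)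
    exact hkl (by simpa using this)
  refine ⟨fun k => L (τ k), fun k => h (τ k), fun k _ => hL _, fun k _ => hL1 _, fun k _ => hL2 _,
    fun k _ => hband _, fun k hk l hl hkl => hdisj _ _ (hτinj k hk l hl hkl), a, ha, b, hb, hab, T,
    hTr, ?_, ?_, fun k hk => hTdisj _ (hτ k hk).1 (hτ k hk).2⟩
  · intro e he
    rcases hTsub e he with h1 | h1 | h1
    · exact q.edges_subset_edgeSet h1
    · exact (hL i).linkageEdges_subset h1
    · exact (hL j).linkageEdges_subset h1
  · intro e he
    rcases hTsub e he with h1 | h1 | h1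
    · refine ⟨hq1 e h1, fun x hx => ht'.separates x (hq2 x ?_)⟩
      exact q.mem_support_of_mem_edges h1 hx
    · exact hband i h1
    · exact hband j h1

/-- If there are arbitrarily many edge-disjoint pairs of disjoint rays equivalent to `R`, then one
vertex and boundedly many edges do not suffice to separate finite sets from the end of `R`. -/
theorem exists_not_separates (R : G.Ray)
    (hpairs : ∀ k : ℕ, ∃ T : Fin k → Bool → G.Ray,
      (∀ i, Disjoint (T i true).verts (T i false).verts) ∧
      (∀ i j, i ≠ j → ∀ b c, Disjoint (T i b).edges (T j c).edges) ∧
      ∀ i b, (T i b).Equivalent R) (K : ℕ) :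
    ∃ U : Finset V, ∀ (Z : Finset V) (F : Finset (Sym2 V)), Z.card ≤ 1 → F.card ≤ K →
      ¬ R.Separates U Z F := by
  classical
  obtain ⟨T, hT1, hT2, hT3⟩ := hpairs (K + 1)
  refine ⟨Finset.univ.image fun p : Fin (K + 1) × Bool => (T p.1 p.2).vertex 0,
    fun Z F hZ hF hsep => ?_⟩
  -- At most `K` edges cannot meet all `K + 1` edge-disjoint pairs, and a single vertex meets at
  -- most one of the two disjoint rays in a pair that is left.
  obtain ⟨i, hi⟩ : ∃ i, ∀ b, Disjoint (T i b).edges F := by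
    by_contra! hno
    simp only [Set.not_disjoint_iff] at hno
    choose b e he heF using hno
    have : Function.Injective fun i => (⟨e i, heF i⟩ : F) := by
      intro i j hij
      by_contra hne
      have hij' : e i = e j := by simpa using hij
      exact Set.disjoint_left.1 (hT2 i j hne _ _) (he i) (hij' ▸ he j)
    have := Fintype.card_le_of_injective _ this
    simp at this
    omega
  obtain ⟨b, hb⟩ : ∃ b, Disjoint (T i b).verts Z := by
    by_contra! hno
    obtain ⟨x, hx, hxZ⟩ := Set.not_disjoint_iff.1 (hno true)
    obtain ⟨y, hy, hyZ⟩ := Set.not_disjoint_iff.1 (hno false)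
    obtain rfl := Finset.card_le_one.1 hZ x hxZ y hyZ
    exact Set.disjoint_left.1 (hT1 i) hx hy
  exact hsep _ (Finset.mem_image.2 ⟨(i, b), by simp, rfl⟩)
    ((hT3 i b).mem_far Z.finite_toSet F.finite_toSet hb (hi b))

theorem IsChain.exists_doubleRays {κ : ℕ} {U Z : ℕ → Finset V} {F : ℕ → Finset (Sym2 V)}
    (hc : R.IsChain (fun n => n + 2) κ U Z F) (hcard : ∀ n, (Z n).card = (Z (n + 1)).card)
    (hq : ∀ n, ∃ z₀ ∈ Z n, ∃ z₁ ∈ Z n, z₀ ≠ z₁ ∧ ∃ q : G.Walk z₀ z₁,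
      (∀ e ∈ q.edges, ∃ x ∈ e, x ∈ R.far (Z n) (F n)) ∧ ∀ x ∈ q.support, x ∈ U (n + 1)) :
    ∃ D : ℕ → G.DoubleRay, Pairwise fun i j => (D i).EdgeDisjoint (D j) := by
  have hlev := fun n => exists_linkages_and_turn (hc.tight n) (hc.covers n) (hc.tight (n + 1))
    (hcard n) (hq n)
  choose L h hL hL1 hL2 hLband hLdisj a ha b hb hab T hTr hTG hTband hTdisj using hlev
  have hD : ∀ l, ∃ D : G.DoubleRay, ∀ e ∈ D.edges,
      e ∈ T l ∨ ∃ n, l < n ∧ e ∈ linkageEdges (L n l) (h n l) := by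
    intro l
    -- The rays start in `Z (l + 1)`, where the turn of level `l` ends. From there on every level
    -- `n` satisfies `l < n` and so has a linkage with index `l`.
    obtain ⟨ρ, hρe, hρ0, -, hρd⟩ := exists_rays_of_linkages (G := G)
      (fun k => (Z (l + 1 + k) : Set V)) (fun k => L (l + 1 + k) l) (fun k => h (l + 1 + k) l)
      (fun k => hL (l + 1 + k) l (by omega))
      (fun n k hnk => hc.disjoint_levels (l + 1) (L := fun n => L n l)
        (fun n hn => hL1 n l (by omega)) (fun n hn => hL2 n l (by omega))
        (fun n hn => (hL n l (by omega)).disjoint) _ _ (by omega) (by omega) (by omega))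
    obtain ⟨D, hD⟩ := exists_doubleRay_of_rays (ρ ⟨a l, ha l⟩) (ρ ⟨b l, hb l⟩)
      (hρd _ _ fun he => hab l (congrArg Subtype.val he)) (T l) (hTG l)
      ⟨a l, ⟨0, hρ0 _⟩, b l, ⟨0, hρ0 _⟩, hTr l⟩
    refine ⟨D, fun e he => ?_⟩
    have : ∀ z, e ∈ (ρ z).edges → ∃ n, l < n ∧ e ∈ linkageEdges (L n l) (h n l) := by
      intro z hz
      obtain ⟨k, hk⟩ := Set.mem_iUnion.1 (hρe z hz)
      exact ⟨l + 1 + k, by omega, hk⟩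
    rcases hD he with (h1 | h1) | h1
    · exact Or.inr (this _ h1)
    · exact Or.inr (this _ h1)
    · exact Or.inl h1
  have hbands : ∀ n k e, e ∈ band (R.far (Z n) (F n)) (R.far (Z (n + 1)) (F (n + 1))) →
      e ∈ band (R.far (Z k) (F k)) (R.far (Z (k + 1)) (F (k + 1))) → n = k := by
    have aux : ∀ n k e, e ∈ band (R.far (Z n) (F n)) (R.far (Z (n + 1)) (F (n + 1))) →
        e ∈ band (R.far (Z k) (F k)) (R.far (Z (k + 1)) (F (k + 1))) → k ≤ n := by
      intro n k e hn hk
      by_contra hlt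
      obtain ⟨x, hx, hxf⟩ := hk.1
      exact hn.2 x hx (hc.far_antitone (by omega : n + 1 ≤ k) hxf)
    exact fun n k e hn hk => le_antisymm (aux k n e hk hn) (aux n k e hn hk)
  choose D hD using hD
  refine ⟨D, fun l l' hne => Set.disjoint_left.2 fun e he he' => ?_⟩
  rcases hD l e he with h1 | ⟨n, hn, h1⟩ <;> rcases hD l' e he' with h2 | ⟨n', hn', h2⟩
  · exact hne (hbands l l' e (hTband l h1) (hTband l' h2))
  · obtain rfl := hbands l n' e (hTband l h1) (hLband n' l' hn' h2)
    exact Set.disjoint_left.1 (hTdisj l l' hn') h1 h2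
  · obtain rfl := hbands l' n e (hTband l' h2) (hLband n l hn h1)
    exact Set.disjoint_left.1 (hTdisj l' l hn) h2 h1
  · obtain rfl := hbands n n' e (hLband n l hn h1) (hLband n' l' hn' h2)
    exact Set.disjoint_left.1 (hLdisj n l hn l' hn' hne) h1 h2

/-- The theorem for an undominated end. -/
theorem exists_doubleRays_of_undominated [Countable V] (R : G.Ray)
    (hdom : ∀ v, ∃ S : Finset V, v ∉ S ∧ v ∉ R.far S ∅) (N : ℕ)
    (hthin : ∀ ρ : Fin (N + 1) → G.Ray, (∀ i, (ρ i).Equivalent R) →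
      ¬ Pairwise fun i j => Disjoint (ρ i).verts (ρ j).verts)
    (hpairs : ∀ k : ℕ, ∃ T : Fin k → Bool → G.Ray,
      (∀ i, Disjoint (T i true).verts (T i false).verts) ∧
      (∀ i j, i ≠ j → ∀ b c, Disjoint (T i b).edges (T j c).edges) ∧
      ∀ i b, (T i b).Equivalent R) :
    ∃ D : ℕ → G.DoubleRay, Pairwise fun i j => (D i).EdgeDisjoint (D j) := by
  classical
  -- The number of vertices is minimised first, with an arbitrary uniform bound on the edges; `κ` is
  -- such a bound for the minimal `d`.
  have hex : ∃ d, ∃ K, ∀ U : Finset V, ∃ (Z : Finset V) (F : Finset (Sym2 V)),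
      Z.card ≤ d ∧ F.card ≤ K ∧ R.Separates U Z F := by
    refine ⟨N, 0, fun U => ?_⟩
    obtain ⟨Z, hZ, hsep⟩ := R.exists_separator_card_le hdom N hthin U
    exact ⟨Z, ∅, hZ, by simp, hsep⟩
  obtain ⟨κ, hκ⟩ := Nat.find_spec hex
  have hmin : ∀ d < Nat.find hex, ∀ K, ∃ U : Finset V, ∀ (Z : Finset V) (F : Finset (Sym2 V)),
      Z.card ≤ d → F.card ≤ K → ¬ R.Separates U Z F := by
    intro d hd K
    have := Nat.find_min hex hd
    push Not at this
    exact this K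
  generalize Nat.find hex = d at hκ hmin
  have hd : 2 ≤ d := by
    by_contra hlt
    obtain ⟨U, hU⟩ := R.exists_not_separates hpairs κ
    obtain ⟨Z, F, hZ, hF, hsep⟩ := hκ U
    exact hU Z F (by omega) hF hsep
  have hnext : ∀ (n : ℕ) (X : Finset V), ∃ (U Z : Finset V) (F : Finset (Sym2 V)),
      X ⊆ U ∧ R.IsTight (n + 2) κ U Z F ∧ Z.card = d := by
    intro n X
    -- The edge bound is chosen so that a separator exceeding it satisfies `robust` through its
    -- edges alone, while one within it must have at least `d` vertices.
    obtain ⟨U₁, hU₁⟩ := hmin (d - 1) (by omega) ((n + 2) * d + 2 * κ)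
    obtain ⟨Z, F, hZ, hF, hsep⟩ := hκ (X ∪ U₁)
    have hlow : ∀ (Y : Finset V) (E : Finset (Sym2 V)), R.Separates (X ∪ U₁) Y E →
        E.card ≤ (n + 2) * d + 2 * κ → d ≤ Y.card := by
      intro Y E hYE hE
      by_contra hlt
      exact hU₁ Y E (by omega) hE (hYE.mono Finset.subset_union_right)
    have hF' : F.card ≤ (n + 2) * d + 2 * κ := by omega
    have hZd : Z.card = d := le_antisymm hZ (hlow Z F hsep hF')
    refine ⟨X ∪ U₁, Z, F, Finset.subset_union_left, ⟨hsep, hF, ?_, ?_⟩, hZd⟩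
    · refine exists_adj_far_of_critical hsep fun z hz h => ?_
      have h1 := hlow _ _ h hF'
      rw [Finset.card_erase_of_mem hz] at h1
      omega
    · intro Y E hYE
      rw [hZd]
      by_cases hE : E.card ≤ (n + 2) * d + 2 * κ
      · have := Nat.mul_le_mul_left (n + 2) (hlow Y E hYE hE)
        omega
      · omega
  have hext : ∀ (Z : Finset V) (F : Finset (Sym2 V)), ∃ X : Finset V,
      (∃ m U, R.IsTight m κ U Z F ∧ 2 ≤ Z.card) →
      ∃ z₀ ∈ Z, ∃ z₁ ∈ Z, z₀ ≠ z₁ ∧ ∃ q : G.Walk z₀ z₁,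
        (∀ e ∈ q.edges, ∃ x ∈ e, x ∈ R.far Z F) ∧ ∀ x ∈ q.support, x ∈ X := by
    intro Z F
    by_cases hZF : ∃ m U, R.IsTight m κ U Z F ∧ 2 ≤ Z.card
    · obtain ⟨m, U, ht, h2⟩ := hZF
      obtain ⟨z₀, h₀, z₁, h₁, hne, q, hq⟩ := ht.exists_walk h2
      exact ⟨q.support.toFinset, fun _ => ⟨z₀, h₀, z₁, h₁, hne, q, hq, by simp⟩⟩
    · exact ⟨∅, fun h => absurd h hZF⟩
  choose ext hext using hext
  obtain ⟨U, Z, F, hc, hQ, hU⟩ := R.exists_isChain (fun n => n + 2) κ hdom (fun Z _ => Z.card = d)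
    ext hnext
  refine hc.exists_doubleRays (fun n => (hQ n).trans (hQ (n + 1)).symm) fun n => ?_
  obtain ⟨z₀, h₀, z₁, h₁, hne, q, hq1, hq2⟩ :=
    hext (Z n) (F n) ⟨_, _, hc.tight n, hd.trans (hQ n).ge⟩
  exact ⟨z₀, h₀, z₁, h₁, hne, q, hq1, fun x hx => hU n (hq2 x hx)⟩

end Ray

end SimpleGraph

/-! ### Dominating vertices of an end and their deletion. -/

namespace SimpleGraph

variable {V : Type*} {G : SimpleGraph V}

namespace Ray

variable {R : G.Ray}

/-- The vertices that dominate the end of `R`. -/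
def dominating (R : G.Ray) : Set V := {v | ∀ S : Finset V, v ∉ S → v ∈ R.far S ∅}

/-- Fresh dominating vertices serve as targets. Fewer than `|Z|` vertices and edges leave a source
and a target untouched, and these two are still connected because both dominate the end; so Menger's
theorem applies even after deleting `A \ Z`. -/
theorem exists_linkage_of_dominating [DecidableEq V] (hinf : R.dominating.Infinite)
    (A Z : Finset V) (hZ : (Z : Set V) ⊆ R.dominating) :
    ∃ (Z' L : Finset V) (h : V → V), (Z' : Set V) ⊆ R.dominating ∧ Z'.card = Z.card ∧
      Disjoint Z' A ∧ (∀ x ∈ L, x ∈ A → x ∈ Z) ∧ G.IsLinkage Z Z' L h := by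
  obtain ⟨Z₀, hZ₀, hcard⟩ := (hinf.sdiff (A ∪ Z).finite_toSet).exists_subset_card_eq Z.card
  have hZ₀A : ∀ z ∈ Z₀, z ∉ A ∧ z ∉ Z := fun z hz => by
    have := (hZ₀ hz).2
    simpa [not_or] using this
  let H : SimpleGraph V := G.cut (A \ Z : Finset V) ∅
  obtain ⟨L, h, hL, -⟩ := H.exists_edgeDisjoint_linkages Z Z₀
    (Finset.disjoint_left.2 fun z hz hz' => (hZ₀A z hz').2 hz) 1 (Or.inl rfl) (by
      intro Y F hYF
      by_contra! hlt
      let Y' : Finset V := Y ∪ F.image fun e => e.out.1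
      have hY' : Y'.card < Z.card := by
        have h2 := Finset.card_union_le Y (F.image fun e => e.out.1)
        have h3 := Finset.card_image_le (s := F) (f := fun e => e.out.1)
        have : Y'.card = (Y ∪ F.image fun e => e.out.1).card := rfl
        omega
      obtain ⟨z, hz, hzY⟩ := Finset.exists_mem_notMem_of_card_lt_card hY'
      obtain ⟨z', hz', hzY'⟩ := Finset.exists_mem_notMem_of_card_lt_card (hcard ▸ hY')
      have h1 : z ∈ R.far ((A \ Z ∪ Y' : Finset V) : Set V) ∅ := hZ hz _ (by simp [hz, hzY])
      have h2 : z' ∈ R.far ((A \ Z ∪ Y' : Finset V) : Set V) ∅ :=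
        (hZ₀ hz').1 _ (by simp [(hZ₀A z' hz').1, hzY'])
      obtain ⟨p⟩ := reachable_of_mem_far h1 h2
      have hle : G.cut ((A \ Z ∪ Y' : Finset V) : Set V) ∅ ≤ H := by
        intro x y hxy
        refine ⟨hxy.1, fun hx => hxy.2.1 ?_, fun hy => hxy.2.2.1 ?_, by simp⟩
        · rw [Finset.coe_union]; exact Or.inl hx
        · rw [Finset.coe_union]; exact Or.inl hy
      have hav : ∀ x ∈ p.support, x ∉ Y' := fun x hx hxY =>
        notMem_of_mem_far (mem_far_of_walk p h1 x hx) (by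
          rw [Finset.coe_union]; exact Or.inr hxY)
      rcases hYF z hz z' hz' (p.mapLe hle) with ⟨x, hx, hxY⟩ | ⟨e, he, heF⟩
      · rw [Walk.support_mapLe_eq_support] at hx
        exact hav x hx (Finset.mem_union_left _ hxY)
      · rw [Walk.edges_mapLe_eq_edges] at he
        exact hav _ (p.mem_support_of_mem_edges he (Sym2.out_fst_mem e))
          (Finset.mem_union_right _ (Finset.mem_image_of_mem _ heF)))
  refine ⟨Z₀, (hL 0).finite.toFinset, h 0, fun z hz => (hZ₀ hz).1, hcard,
    Finset.disjoint_left.2 fun z hz => (hZ₀A z hz).1, fun x hx hxA => ?_, ?_⟩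
  · by_contra hxZ
    have := ((hL 0).adj x (by simpa using hx)).2.1
    exact this (by simp [hxA, hxZ])
  · rw [Set.Finite.coe_toFinset]
    exact (hL 0).mono cut_le

/-- An end that is dominated by infinitely many vertices contains arbitrarily many disjoint
rays. -/
theorem exists_rays_of_dominating (hinf : R.dominating.Infinite) (k : ℕ) :
    ∃ ρ : Fin k → G.Ray, (∀ i, (ρ i).Equivalent R) ∧
      Pairwise fun i j => Disjoint (ρ i).verts (ρ j).verts := by
  classical
  -- The first component collects all vertices used so far, the second the current endpoints of the
  -- paths.
  let State := {s : Finset V × Finset V // s.2 ⊆ s.1 ∧ (s.2 : Set V) ⊆ R.dominating ∧ s.2.card = k}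
  choose z l h hz hcard hzA hlA hl using fun s : State =>
    exists_linkage_of_dominating hinf s.1.1 s.1.2 s.2.2.1
  obtain ⟨Z₀, hZ₀, hk⟩ := hinf.exists_subset_card_eq k
  let next : State → State := fun s => ⟨(s.1.1 ∪ l s ∪ z s, z s), Finset.subset_union_right, hz s,
    (hcard s).trans s.2.2.2⟩
  let s : ℕ → State := fun n => next^[n] ⟨(Z₀, Z₀), subset_rfl, hZ₀, hk⟩
  have hs : ∀ n, s (n + 1) = next (s n) := fun n => Function.iterate_succ_apply' _ _ _
  let A : ℕ → Finset V := fun n => (s n).1.1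
  let Z : ℕ → Finset V := fun n => (s n).1.2
  have hA : ∀ n, A (n + 1) = A n ∪ l (s n) ∪ z (s n) := fun n => by
    simp only [A, hs]; rfl
  have hZ : ∀ n, Z (n + 1) = z (s n) := fun n => by simp only [Z, hs]; rfl
  have hAmono : Monotone A := monotone_nat_of_le_succ fun n => by
    rw [hA, Finset.union_assoc]; exact Finset.subset_union_left
  have hlA' : ∀ n, l (s n) ⊆ A (n + 1) := fun n x hx => by
    rw [hA]; simp [hx]
  have hL : ∀ n, G.IsLinkage (Z n) (Z (n + 1)) (l (s n)) (h (s n)) := fun n => by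
    rw [hZ]; exact hl (s n)
  have hdisj : ∀ n k, n ≠ k → Disjoint (l (s n) : Set V) (l (s k)) := by
    have key : ∀ n k, n < k → Disjoint (l (s n) : Set V) (l (s k)) := by
      intro n k hnk
      rw [Set.disjoint_left]
      intro x hx hxk
      have hxZ : x ∈ Z k := hlA (s k) x hxk (hAmono (show n + 1 ≤ k from hnk) (hlA' n hx))
      obtain ⟨k, rfl⟩ := Nat.exists_eq_add_of_lt hnk
      cases k with
      | zero => exact Set.disjoint_left.1 (hL n).disjoint hx hxZ
      | succ k =>
        have hxz : x ∈ z (s (n + (k + 1))) := (hZ (n + (k + 1))) ▸ hxZ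
        exact Finset.disjoint_left.1 (hzA _) hxz
          (hAmono (show n + 1 ≤ n + (k + 1) by omega) (hlA' n hx))
    intro n k hne
    rcases Nat.lt_or_gt_of_ne hne with h | h
    · exact key n k h
    · exact (key k n h).symm
  obtain ⟨ρ, -, -, hρ, hρd⟩ := exists_rays_of_linkages (fun n => (Z n : Set V))
    (fun n => (l (s n) : Set V)) (fun n => h (s n)) hL hdisj
  obtain ⟨e⟩ : Nonempty (Fin k ↪ (Z 0 : Set V)) := by
    apply Function.Embedding.nonempty_of_card_le
    have : (Z 0).card = k := (s 0).2.2.2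
    simp [this]
  refine ⟨fun i => ρ (e i), fun i => ?_, fun i j hij => hρd _ _ (e.injective.ne hij)⟩
  refine equivalent_of_forall_exists_mem_far fun S hS => ?_
  -- Each ray passes through infinitely many dominating vertices. One that lies beyond a given
  -- finite set `S` is not separated by `S` from the end.
  choose t ht using hρ (e i)
  have htinj : Function.Injective t := by
    intro n k hnk
    by_contra hne
    exact Set.disjoint_left.1 (hdisj n k hne) ((hL n).source_subset (ht n))
      ((hL k).source_subset (hnk ▸ ht k))
  obtain ⟨N, hN⟩ := (ρ (e i)).exists_tail hS
  obtain ⟨n, hn⟩ : ∃ n, N ≤ t n := by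
    by_contra! hlt
    exact Set.infinite_range_of_injective htinj ((Set.finite_Iio N).subset (by
      rintro _ ⟨n, rfl⟩
      exact hlt n))
  refine ⟨t n, ?_⟩
  have := (s n).2.2.1 (ht n) hS.toFinset (by simpa using hN _ hn)
  rwa [Set.Finite.coe_toFinset] at this

/-- A ray of a subgraph as a ray of the whole graph. -/
def mapLe {H : SimpleGraph V} (hGH : G ≤ H) (R : G.Ray) : H.Ray :=
  ⟨R.vertex, R.injective, fun i => hGH (R.adj i)⟩

theorem mapLe_vertex {H : SimpleGraph V} (hGH : G ≤ H) (R : G.Ray) (n : ℕ) :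
    (R.mapLe hGH).vertex n = R.vertex n := rfl

theorem exists_tail_cut (R : G.Ray) {X : Set V} (hX : X.Finite) :
    ∃ (T : (G.cut X ∅).Ray) (N : ℕ), ∀ n, T.vertex n = R.vertex (n + N) := by
  obtain ⟨N, hN⟩ := R.exists_tail hX
  refine ⟨⟨fun n => R.vertex (n + N), fun a b hab => ?_, fun n => ⟨?_, hN _ (by omega),
    hN _ (by omega), by simp⟩⟩, N, fun n => rfl⟩
  · have := R.injective hab
    omega
  · have := R.adj (n + N)
    rwa [add_right_comm] at this

theorem verts_subset_of_eq {H : SimpleGraph V} {T : H.Ray} {N : ℕ}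
    (h : ∀ n, T.vertex n = R.vertex (n + N)) : T.verts ⊆ R.verts := by
  rintro _ ⟨n, rfl⟩
  exact ⟨n + N, (h n).symm⟩

theorem edges_subset_of_eq {H : SimpleGraph V} {T : H.Ray} {N : ℕ}
    (h : ∀ n, T.vertex n = R.vertex (n + N)) : T.edges ⊆ R.edges := by
  rintro _ ⟨n, rfl⟩
  refine ⟨n + N, ?_⟩
  simp only [h, add_right_comm n 1 N]

/-- Deleting finitely many vertices does not affect the equivalence of rays. -/
theorem equivalent_cut_iff {X : Set V} (hX : X.Finite) {R' : (G.cut X ∅).Ray} {N : ℕ}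
    (hR' : ∀ n, R'.vertex n = R.vertex (n + N)) (T : (G.cut X ∅).Ray) :
    T.Equivalent R' ↔ (T.mapLe cut_le : G.Ray).Equivalent R := by
  rw [equivalent_iff, equivalent_iff]
  constructor
  · intro h S hS
    obtain ⟨m, n, p, hp⟩ := h S hS
    refine ⟨m, n + N, (p.mapLe cut_le).copy (mapLe_vertex _ T m).symm (hR' n), fun x hx => hp x ?_⟩
    rwa [Walk.support_copy, Walk.support_mapLe_eq_support] at hx
  · intro h S hS
    obtain ⟨m, n, p, hp⟩ := h (S ∪ X ∪ R.vertex '' Set.Iio N)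
      ((hS.union hX).union ((Set.finite_Iio N).image _))
    have hn : N ≤ n := by
      by_contra hlt
      exact hp _ p.end_mem_support (Or.inr ⟨n, not_le.mp hlt, rfl⟩)
    obtain ⟨n, rfl⟩ := Nat.exists_eq_add_of_le' hn
    have hpX : ∀ e ∈ p.edges, e ∈ (G.cut X ∅).edgeSet := by
      intro e he
      induction e with
      | _ a b =>
        exact ⟨p.adj_of_mem_edges he,
          fun ha => hp a (p.fst_mem_support_of_mem_edges he) (Or.inl (Or.inr ha)),
          fun hb => hp b (p.snd_mem_support_of_mem_edges he) (Or.inl (Or.inr hb)), by simp⟩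
    refine ⟨m, n, (p.transfer _ hpX).copy (mapLe_vertex _ T m) (hR' n).symm, fun x hx hxS => ?_⟩
    rw [Walk.support_copy, Walk.support_transfer] at hx
    exact hp x hx (Or.inl (Or.inl hxS))

theorem far_cut_subset {X S : Set V} {R' : (G.cut X ∅).Ray} {N : ℕ}
    (hR' : ∀ n, R'.vertex n = R.vertex (n + N)) : R'.far S ∅ ⊆ R.far (S ∪ X) ∅ := by
  rintro v ⟨n₀, hn⟩
  refine ⟨n₀ + N, fun n hn' => ?_⟩
  obtain ⟨n, rfl⟩ := Nat.exists_eq_add_of_le' (show N ≤ n by omega)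
  rw [← hR']
  refine (hn n (by omega)).mono fun x y hxy => ?_
  obtain ⟨⟨h1, h2, h3, _⟩, h4, h5, _⟩ := hxy
  exact ⟨h1, fun h => h.elim h4 h2, fun h => h.elim h5 h3, by simp⟩

end Ray

theorem RayEnd.IsThin.exists_bound {ω : G.RayEnd} (hω : ω.IsThin) :
    ∃ N : ℕ, ∀ ρ : Fin (N + 1) → G.Ray, (∀ i, (ρ i).ConvergesTo ω) →
      ¬ Pairwise fun i j => Disjoint (ρ i).verts (ρ j).verts := by
  obtain ⟨N, hN⟩ := ENat.ne_top_iff_exists.1 hω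
  refine ⟨N, fun ρ hρ hdisj => ?_⟩
  have hinj : Function.Injective ρ := by
    intro i j hij
    by_contra hne
    exact Set.disjoint_left.1 (hdisj hne) ⟨0, rfl⟩ (hij ▸ ⟨0, rfl⟩)
  have h1 : (Set.range ρ).encard ≤ ω.vertexDegree := by
    refine le_iSup₂_of_le (Set.range ρ) ⟨?_, ?_⟩ le_rfl
    · rintro _ ⟨i, rfl⟩
      exact hρ i
    · rintro _ ⟨i, rfl⟩ _ ⟨j, rfl⟩ hne
      exact hdisj fun h => hne (h ▸ rfl)
  rw [← hN, ← Set.image_univ, hinj.encard_image, Set.encard_univ] at h1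
  simp only [ENat.card_eq_coe_fintype_card, Fintype.card_fin] at h1
  have : N + 1 ≤ N := by exact_mod_cast h1
  omega

/-! ### Halves of double rays, and the reduction to undominated ends. -/

namespace DoubleRay

/-- The forward half of a double ray. -/
def forward (D : G.DoubleRay) : G.Ray :=
  ⟨fun n => D.vertex n, fun a b hab => by simpa using D.injective hab, fun n => by
    have := D.adj n
    exact_mod_cast this⟩

/-- The backward half of a double ray, without its common vertex with the forward half. -/
def backward (D : G.DoubleRay) : G.Ray :=
  ⟨fun n => D.vertex (-(n + 1)), fun a b hab => by
    have := D.injective hab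
    omega, fun n => by
    have := (D.adj (-((n + 1 : ℕ) + 1))).symm
    convert this using 2
    push_cast
    ring⟩

theorem includes_forward (D : G.DoubleRay) : D.Includes D.forward := by
  constructor
  · rintro _ ⟨n, rfl⟩
    exact ⟨n, rfl⟩
  · rintro _ ⟨n, rfl⟩
    exact ⟨n, by simp [forward]⟩

theorem includes_backward (D : G.DoubleRay) : D.Includes D.backward := by
  constructor
  · rintro _ ⟨n, rfl⟩
    exact ⟨-(n + 1), rfl⟩
  · rintro _ ⟨n, rfl⟩
    refine ⟨-((n + 1 : ℕ) + 1), ?_⟩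
    simp only [backward]
    rw [Sym2.eq_swap]
    congr 3

theorem disjoint_forward_backward (D : G.DoubleRay) :
    Disjoint D.forward.verts D.backward.verts := by
  rw [Set.disjoint_left]
  rintro _ ⟨n, rfl⟩ ⟨k, hk⟩
  have := D.injective hk
  omega

/-- A double ray of a subgraph as a double ray of the whole graph. -/
def mapLe {H : SimpleGraph V} (hGH : G ≤ H) (D : G.DoubleRay) : H.DoubleRay :=
  ⟨D.vertex, D.injective, fun i => hGH (D.adj i)⟩

end DoubleRay

end SimpleGraph

theorem mainTheorem3 {V : Type*} [Countable V] (G : SimpleGraph V)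
    (ω : G.RayEnd) (hω : ω.IsThin)
    (h : ∀ k : ℕ, ∃ D : Fin k → G.DoubleRay,
      (Pairwise fun i j => (D i).EdgeDisjoint (D j)) ∧
        ∀ i, ∀ R : G.Ray, (D i).Includes R → R.ConvergesTo ω) :
    ∃ D : ℕ → G.DoubleRay, Pairwise fun i j => (D i).EdgeDisjoint (D j) := by
  classical
  obtain ⟨R, rfl⟩ := Quotient.exists_rep ω
  have hconv : ∀ T : G.Ray, T.ConvergesTo (Quotient.mk G.raySetoid R) ↔ T.Equivalent R :=
    fun T => Quotient.eq (r := G.raySetoid)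
  obtain ⟨N, hN⟩ := hω.exists_bound
  have hfin : R.dominating.Finite := by
    by_contra hinf
    obtain ⟨ρ, hρ, hdisj⟩ := SimpleGraph.Ray.exists_rays_of_dominating hinf (N + 1)
    exact hN ρ (fun i => (hconv _).2 (hρ i)) hdisj
  obtain ⟨R', M, hR'⟩ := R.exists_tail_cut hfin
  have hequiv := SimpleGraph.Ray.equivalent_cut_iff hfin hR'
  obtain ⟨D, hD⟩ := R'.exists_doubleRays_of_undominated (by
    intro v
    by_cases hv : v ∈ R.dominating
    -- The vertices deleted by `cut` remain as isolated vertices, so the empty set already separates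
    -- them from the end.
    · exact ⟨∅, by simp, fun hf => SimpleGraph.Ray.notMem_of_mem_far
        (SimpleGraph.Ray.far_cut_subset hR' hf) (Or.inr hv)⟩
    · simp only [SimpleGraph.Ray.dominating, Set.mem_ofPred_eq, not_forall] at hv
      obtain ⟨S, hvS, hvf⟩ := hv
      refine ⟨S, hvS, fun hf => hvf (SimpleGraph.Ray.far_anti ?_
        (SimpleGraph.Ray.far_cut_subset hR' hf))⟩
      exact fun x y hxy => ⟨hxy.1, fun hx => hxy.2.1 (Or.inl hx),
        fun hy => hxy.2.2.1 (Or.inl hy), hxy.2.2.2⟩) N (by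
    intro ρ hρ hdisj
    exact hN (fun i => (ρ i).mapLe SimpleGraph.cut_le)
      (fun i => (hconv _).2 ((hequiv _).1 (hρ i))) hdisj) (by
    intro k
    obtain ⟨D, hD, hDω⟩ := h k
    -- The halves of a double ray may contain deleted vertices, but only finitely many, so tails of
    -- both halves survive.
    have hT : ∀ i (b : Bool), ∃ (T : (G.cut R.dominating ∅).Ray) (n : ℕ),
        ∀ j, T.vertex j = (if b then (D i).forward else (D i).backward).vertex (j + n) :=
      fun i b => SimpleGraph.Ray.exists_tail_cut _ hfin
    choose T n hT using hT
    have hinc : ∀ i (b : Bool), (D i).Includes (if b then (D i).forward else (D i).backward) := by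
      intro i b
      cases b
      · exact (D i).includes_backward
      · exact (D i).includes_forward
    have hTe : ∀ i b, (T i b).edges ⊆ (D i).edges := fun i b =>
      (SimpleGraph.Ray.edges_subset_of_eq (hT i b)).trans (hinc i b).2
    have hTv : ∀ i b, (T i b).verts ⊆ (D i).verts := fun i b =>
      (SimpleGraph.Ray.verts_subset_of_eq (hT i b)).trans (hinc i b).1
    refine ⟨T, fun i => ?_, fun i j hij b c => (hD hij).mono (hTe i b) (hTe j c), fun i b => ?_⟩
    · exact (D i).disjoint_forward_backward.mono
        (SimpleGraph.Ray.verts_subset_of_eq (hT i true))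
        (SimpleGraph.Ray.verts_subset_of_eq (hT i false))
    · exact (hequiv _).2 ((hconv _).1 (hDω i ((T i b).mapLe SimpleGraph.cut_le)
        ⟨hTv i b, hTe i b⟩)))
  exact ⟨fun i => (D i).mapLe SimpleGraph.cut_le, fun i j hij => hD hij⟩
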